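/- Let $0<s<1$, $\tau>0$, $\Omega=(-1,1)$, let $\omega\subset\Omega$ be measurable and let $\varphi_0\in L^2(\Omega)$. Let $H_0^s(\Omega)$ be the space of all $u\in L^2(\mathbb R)$ with $\int_{\mathbb R}\int_{\mathbb R}\frac{|u(x)-u(y)|^2}{|x-y|^{1+2s}}\,dx\,dy<\infty$ and $u=0$ a.e. in $\mathbb R\setminus\Omega$, with the norm of $H^s(\mathbb R)$, let $H^{-s}(\Omega)$ be its dual with pivot space $L^2(\Omega)$, and let $$\mathcal F(u,v)=\frac{C_s}{2}\int_{\mathbb R}\int_{\mathbb R}\frac{(u(x)-u(y))(v(x)-v(y))}{|x-y|^{1+2s}}\,dx\,dy,\qquad C_s=\frac{s2^{2s}\Gamma\left(\frac{2s+1}{2}\right)}{\pi^{1/2}\Gamma(1-s)},$$ be the bilinear form of the fractional Laplacian $(-\partial_x^2)^s$ with zero exterior condition. A finite-energy solution of $\pm\partial_t u+(-\partial_x^2)^s u=F$ in $\Omega\times(0,\tau)$, $u=0$ in $(\mathbb R\setminus\Omega)\times(0,\tau)$, is a function $u\in L^2(0,\tau;H_0^s(\Omega))\cap C([0,\tau];L^2(\Omega))$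 with $u_t\in L^2(0,\tau;H^{-s}(\Omega))$ such that $$\pm\int_0^\tau\langle u_t,w\rangle\,dt+\int_0^\tau\mathcal F(u,w)\,dt=\int_0^\tau\langle F,w\rangle\,dt\qquad\text{for all } w\in L^2(0,\tau;H_0^s(\Omega)).$$ For $h\in L^2(0,\tau;L^2(\omega))$, the state $\phi$ of $h$ is the finite-energy solution of $$-\partial_t\phi+(-\partial_x^2)^s\phi=h\chi_{\omega\times(0,\tau)}\ \text{in }\Omega\times(0,\tau),\qquad \phi=0\ \text{in }(\mathbb R\setminus\Omega)\times(0,\tau),\qquad \phi(\cdot,\tau)=\varphi_0\ \text{in }\Omega. \tag{1}$$ For $\varepsilon>0$ put $J_\varepsilon(h)=\frac12\int_0^\tau\int_\omega|h|^2\,dx\,dt+\frac\varepsilon2\|\phi(\cdot,0)\|_{L^2(\Omega)}^2$, where $\phi$ is the state of $h$. **Theorem.** Let $\varepsilon>0$ and let $h_\varepsilon$ be a minimizer of $J_\varepsilon$ over $L^2(0,\tau;L^2(\omega))$, with associated state $\phi_\varepsilon$. Then $(h_\varepsilon,\phi_\varepsilon)$ satisfies the optimality system: $\phi_\varepsilon$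 exists and solves (1) with $h=h_\varepsilon$; the adjoint problem $$\partial_t p_\varepsilon+(-\partial_x^2)^s p_\varepsilon=0\ \text{in }\Omega\times(0,\tau),\qquad p_\varepsilon=0\ \text{in }(\mathbb R\setminus\Omega)\times(0,\tau),\qquad p_\varepsilon(\cdot,0)=\varepsilon\phi_\varepsilon(\cdot,0)\ \text{in }\Omega$$ has a finite-energy solution $p_\varepsilon\in C([0,\tau];L^2(\Omega))$; and every such solution satisfies $$h_\varepsilon+p_\varepsilon=0\quad\text{a.e. in }\omega\times(0,\tau).$$ -/

import Mathlib

open MeasureTheory Set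

noncomputable section

namespace FracHeat

/-- The interval `Ω = (-1,1)`. -/
abbrev Omega : Set ℝ := Ioo (-1) 1

/-- The real Hilbert space `L²(E)` of a set `E ⊆ ℝ`, with Lebesgue measure. -/
abbrev L2 (E : Set ℝ) : Type := Lp ℝ 2 (volume.restrict E)

/-- The normalization constant `C_s = s 2^{2s} Γ((2s+1)/2) / (π^{1/2} Γ(1-s))`. -/
def fracConst (s : ℝ) : ℝ :=
  s * (2 : ℝ) ^ (2 * s) * Real.Gamma ((2 * s + 1) / 2) / (Real.sqrt Real.pi * Real.Gamma (1 - s))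

/-- The Gagliardo difference quotient `(u(x) - u(y)) / |x - y|^{(1+2s)/2}`, whose square is
`|u(x) - u(y)|² / |x - y|^{1+2s}`. -/
def diffQuot (s : ℝ) (u : ℝ → ℝ) (q : ℝ × ℝ) : ℝ :=
  (u q.1 - u q.2) / |q.1 - q.2| ^ ((1 + 2 * s) / 2)

/-- Changing `u` on a null set changes its difference quotient only on a null set. -/
lemma diffQuot_congr (s : ℝ) {u v : ℝ → ℝ} (h : u =ᵐ[volume] v) :
    diffQuot s u =ᵐ[volume] diffQuot s v := by
  have h1 : ∀ᵐ q : ℝ × ℝ, u q.1 = v q.1 :=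
    Measure.quasiMeasurePreserving_fst.ae_eq_comp h
  have h2 : ∀ᵐ q : ℝ × ℝ, u q.2 = v q.2 :=
    Measure.quasiMeasurePreserving_snd.ae_eq_comp h
  filter_upwards [h1, h2] with q hq1 hq2
  simp only [diffQuot, hq1, hq2]

/-- The Hilbert space `H_0^s(Ω)` of all `u ∈ L²(ℝ)` with
`∫∫ |u(x) - u(y)|² / |x - y|^{1+2s} dx dy < ∞` and `u = 0` a.e. in `ℝ \ Ω`.

Such a `u` is stored together with its difference quotient, as the point `(u, diffQuot s u)` of
`L²(ℝ) ⊕ L²(ℝ²)`: that the second component lies in `L²(ℝ²)` says exactly that the double integral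
is finite, and the norm inherited from the Hilbert sum is
`(∫ |u|² + ∫∫ |u(x) - u(y)|² / |x - y|^{1+2s})^{1/2}`, the norm of `H^s(ℝ)`. -/
def hZero (s : ℝ) : Submodule ℝ
    (WithLp 2 (Lp ℝ 2 (volume : Measure ℝ) × Lp ℝ 2 (volume : Measure (ℝ × ℝ)))) where
  carrier := {z | (z.snd : ℝ × ℝ → ℝ) =ᵐ[volume] diffQuot s z.fst ∧
    ∀ᵐ x : ℝ, x ∉ Omega → z.fst x = 0}
  zero_mem' := by
    refine ⟨?_, ?_⟩
    · rw [WithLp.zero_snd, WithLp.zero_fst]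
      filter_upwards [Lp.coeFn_zero ℝ 2 (volume : Measure (ℝ × ℝ)),
        diffQuot_congr s (Lp.coeFn_zero ℝ 2 (volume : Measure ℝ))] with q h1 h2
      rw [h1, h2]
      simp [diffQuot]
    · rw [WithLp.zero_fst]
      filter_upwards [Lp.coeFn_zero ℝ 2 (volume : Measure ℝ)] with x h1 _
      rw [h1]
      rfl
  add_mem' := by
    rintro a b ⟨ha, ha'⟩ ⟨hb, hb'⟩
    refine ⟨?_, ?_⟩
    · rw [WithLp.add_snd, WithLp.add_fst]
      filter_upwards [Lp.coeFn_add a.snd b.snd,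
        diffQuot_congr s (Lp.coeFn_add a.fst b.fst), ha, hb] with q h1 h2 h3 h4
      rw [h1, h2, Pi.add_apply, h3, h4]
      simp only [diffQuot, Pi.add_apply]
      ring
    · rw [WithLp.add_fst]
      filter_upwards [Lp.coeFn_add a.fst b.fst, ha', hb'] with x h1 h2 h3 hx
      rw [h1, Pi.add_apply, h2 hx, h3 hx, add_zero]
  smul_mem' := by
    rintro c a ⟨ha, ha'⟩
    refine ⟨?_, ?_⟩
    · rw [WithLp.smul_snd, WithLp.smul_fst]
      filter_upwards [Lp.coeFn_smul c a.snd,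
        diffQuot_congr s (Lp.coeFn_smul c a.fst), ha] with q h1 h2 h3
      rw [h1, h2, Pi.smul_apply, h3]
      simp only [diffQuot, Pi.smul_apply, smul_eq_mul]
      ring
    · rw [WithLp.smul_fst]
      filter_upwards [Lp.coeFn_smul c a.fst, ha'] with x h1 h2 hx
      rw [h1, Pi.smul_apply, h2 hx, smul_zero]

/-- `H_0^s(Ω)` as a type, with its inner product. -/
def HZero (s : ℝ) : Type := hZero s

instance (s : ℝ) : NormedAddCommGroup (HZero s) := inferInstanceAs (NormedAddCommGroup (hZero s))

instance (s : ℝ) : InnerProductSpace ℝ (HZero s) := inferInstanceAs (InnerProductSpace ℝ (hZero s))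

/-- The inclusion of `H_0^s(Ω)` in the Hilbert sum `L²(ℝ) ⊕ L²(ℝ²)`. -/
def HZero.incl (s : ℝ) : HZero s →L[ℝ]
    WithLp 2 (Lp ℝ 2 (volume : Measure ℝ) × Lp ℝ 2 (volume : Measure (ℝ × ℝ))) :=
  (hZero s).subtypeL

/-- `H^{-s}(Ω)`, the dual of `H_0^s(Ω)`. -/
abbrev HNeg (s : ℝ) : Type := StrongDual ℝ (HZero s)

/-- The function `u ∈ L²(ℝ)` underlying an element of `H_0^s(Ω)`. -/
def HZero.toL2 {s : ℝ} (u : HZero s) : Lp ℝ 2 (volume : Measure ℝ) :=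
  (HZero.incl s u).fst

/-- The restriction map `H_0^s(Ω) → L²(E)`, `u ↦ u|_E`. For `E = Ω` it is the embedding
`H_0^s(Ω) ↪ L²(Ω)`. -/
def restrictTo (s : ℝ) (E : Set ℝ) : HZero s →L[ℝ] L2 E :=
  (LpToLpRestrictCLM ℝ ℝ ℝ volume 2 E).comp
    ((WithLp.fstL 2 ℝ (Lp ℝ 2 (volume : Measure ℝ)) (Lp ℝ 2 (volume : Measure (ℝ × ℝ)))).comp
      (HZero.incl s))

/-- For `f ∈ L²(E)`, the functional `v ↦ ∫_E f v dx` on `H_0^s(Ω)`. For `E = Ω` this is the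
embedding `L²(Ω) ↪ H^{-s}(Ω)`; for `E = ω ⊆ Ω` it is `f χ_ω` as an element of `H^{-s}(Ω)`. -/
def toHNeg (s : ℝ) (E : Set ℝ) (f : L2 E) : HNeg s :=
  (innerSL ℝ f).comp (restrictTo s E)

/-- The bilinear form
`𝓕(u,v) = (C_s / 2) ∫∫_{ℝ²} (u(x) - u(y)) (v(x) - v(y)) / |x - y|^{1+2s} dx dy`
of the fractional Laplacian with zero exterior values. -/
def fracForm (s : ℝ) (u v : HZero s) : ℝ :=
  fracConst s / 2 * ∫ q : ℝ × ℝ,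
    (u.toL2 q.1 - u.toL2 q.2) * (v.toL2 q.1 - v.toL2 q.2) / |q.1 - q.2| ^ (1 + 2 * s)

/-- `y ∈ L²(0,τ; H_0^s(Ω))` has the distributional time derivative
`y' ∈ L²(0,τ; H^{-s}(Ω))`: for all `η ∈ C_c^∞(0,τ)`, `∫ η' y dt = - ∫ η y' dt` in `H^{-s}(Ω)`.
In other words, `y ∈ W(0,τ)` and `y_t = y'`. -/
structure InW (s τ : ℝ) (y : ℝ → HZero s) (y' : ℝ → HNeg s) : Prop where
  memLp : MemLp y 2 (volume.restrict (Ioo 0 τ))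
  memLp_deriv : MemLp y' 2 (volume.restrict (Ioo 0 τ))
  weak_deriv : ∀ η : ℝ → ℝ, ContDiff ℝ (⊤ : ℕ∞) η → HasCompactSupport η → tsupport η ⊆ Ioo 0 τ →
    ∫ t in Ioo 0 τ, deriv η t • toHNeg s Omega (restrictTo s Omega (y t)) =
      -∫ t in Ioo 0 τ, η t • y' t

/-- `u` is the finite-energy solution, in `W(0,τ) ∩ C([0,τ]; L²(Ω))`, of the forward problem
`u_t + (-∂_x²)^s u = F` in `Ω × (0,τ)`, `u = 0` in `(ℝ \ Ω) × (0,τ)`, `u(·,0) = u₀` in `Ω`.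
Only the values `u t` with `t ∈ [0,τ]` matter. -/
structure IsForwardSolution (s τ : ℝ) (F : ℝ → HNeg s) (u₀ : L2 Omega) (u : ℝ → L2 Omega) :
    Prop where
  continuousOn : ContinuousOn u (Icc 0 τ)
  initial : u 0 = u₀
  equation : ∃ (y : ℝ → HZero s) (y' : ℝ → HNeg s), InW s τ y y' ∧
    (∀ᵐ t ∂volume.restrict (Ioo 0 τ), u t = restrictTo s Omega (y t)) ∧
    ∀ w : ℝ → HZero s, MemLp w 2 (volume.restrict (Ioo 0 τ)) →
      (∫ t in Ioo 0 τ, y' t (w t)) + ∫ t in Ioo 0 τ, fracForm s (y t) (w t) =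
        ∫ t in Ioo 0 τ, F t (w t)

/-- `u` is the finite-energy solution, in `W(0,τ) ∩ C([0,τ]; L²(Ω))`, of the backward problem
`-u_t + (-∂_x²)^s u = F` in `Ω × (0,τ)`, `u = 0` in `(ℝ \ Ω) × (0,τ)`, `u(·,τ) = u₁` in `Ω`.
Only the values `u t` with `t ∈ [0,τ]` matter. -/
structure IsBackwardSolution (s τ : ℝ) (F : ℝ → HNeg s) (u₁ : L2 Omega) (u : ℝ → L2 Omega) :
    Prop where
  continuousOn : ContinuousOn u (Icc 0 τ)
  terminal : u τ = u₁
  equation : ∃ (y : ℝ → HZero s) (y' : ℝ → HNeg s), InW s τ y y' ∧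
    (∀ᵐ t ∂volume.restrict (Ioo 0 τ), u t = restrictTo s Omega (y t)) ∧
    ∀ w : ℝ → HZero s, MemLp w 2 (volume.restrict (Ioo 0 τ)) →
      -(∫ t in Ioo 0 τ, y' t (w t)) + ∫ t in Ioo 0 τ, fracForm s (y t) (w t) =
        ∫ t in Ioo 0 τ, F t (w t)

/-- The space of controls `L²(0,τ; L²(ω))`. -/
abbrev Control (τ : ℝ) (ω : Set ℝ) : Type := Lp (L2 ω) 2 (volume.restrict (Ioo 0 τ))

/-- `φ` is the state of the control `h`: the solution of `-φ_t + (-∂_x²)^s φ = h χ_{ω × (0,τ)}` in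
`Ω × (0,τ)`, `φ = 0` in `(ℝ \ Ω) × (0,τ)`, `φ(·,τ) = φ₀` in `Ω`. -/
def IsState (s τ : ℝ) (ω : Set ℝ) (φ₀ : L2 Omega) (h : Control τ ω) (φ : ℝ → L2 Omega) : Prop :=
  IsBackwardSolution s τ (fun t => toHNeg s ω (h t)) φ₀ φ

/-- `p` is the adjoint state with initial datum `p₀`: the solution of `p_t + (-∂_x²)^s p = 0` in
`Ω × (0,τ)`, `p = 0` in `(ℝ \ Ω) × (0,τ)`, `p(·,0) = p₀` in `Ω`. -/
def IsAdjointState (s τ : ℝ) (p₀ : L2 Omega) (p : ℝ → L2 Omega) : Prop :=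
  IsForwardSolution s τ 0 p₀ p

/-- The cost `½ ∫_0^τ ∫_ω |h|² dx dt + (ε/2) ‖φ(·,0)‖²_{L²(Ω)}`. -/
def cost {τ : ℝ} {ω : Set ℝ} (ε : ℝ) (h : Control τ ω) (φ : ℝ → L2 Omega) : ℝ :=
  1 / 2 * (∫ t in Ioo 0 τ, ∫ x in ω, |h t x| ^ 2) + ε / 2 * ‖φ 0‖ ^ 2

/-- `h` minimizes, over all of `L²(0,τ; L²(ω))`, the functional `J_ε` whose value at a control is
its cost taken with its state. -/
def IsMinimizer (s τ ε : ℝ) (ω : Set ℝ) (φ₀ : L2 Omega) (h : Control τ ω) : Prop :=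
  ∀ φ : ℝ → L2 Omega, IsState s τ ω φ₀ h φ →
    ∀ (k : Control τ ω) (ψ : ℝ → L2 Omega), IsState s τ ω φ₀ k ψ → cost ε h φ ≤ cost ε k ψ

end FracHeat

end

/-!
The optimality condition is the Euler–Lagrange equation of the quadratic functional `J_ε`. In a
direction `k` let `z` solve the backward problem with source `k χ_ω` and terminal value `0`. Then
`φ + c z` is the state of `h + c k`, so minimality gives `⟪h, k⟫ + ε ⟪φ(0), z(0)⟫ = 0`
(`IsMinimizer.inner_add_eq_zero`). Green's formula for `z` and an adjoint state `p` with
`p(0) = ε φ(0)` turns the second term into `∫ ⟪k, p⟫_ω` (`exists_isBackwardSolution`). Hence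
`⟪h + p, k⟫ = 0` for every `k`, and `k = h + p` gives the claim. No uniqueness theorem is needed: it
suffices that one solution `z` satisfies Green's formula against all adjoint states.

Existence comes from an abstract argument for a dense embedding `ι : V → H` of Hilbert spaces and a
coercive operator `B` on `V`. A *trajectory* is a primitive `w(t) = a + ∫₀ᵗ v` with `a ∈ V` and
`v ∈ L²(0,τ; V)`; it solves `w_t + B w = f` for the source `f` computed from it. For such functions,
integration by parts is Fubini's theorem (`bilin_primitive_sub`) and gives the energy estimate
(`energy_estimate`). The sources of the trajectories starting at `0` are dense in `L²(0,τ; V')`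
(`dense_range_source`), because a function orthogonal to all of them yields a solution of the
homogeneous adjoint problem. So arbitrary data are limits of data of trajectories, and the energy
estimate makes the trajectories converge (`exists_isLimitSolution`). Green's formula
(`IsLimitSolution.green`) is proved for trajectories and passes to the limit; the other factor only
has to be a primitive of its weak derivative, which is the lemma of du Bois-Reymond
(`eq_of_weak_deriv_eq_zero`).

For the fractional Laplacian, `V = H_0^s(Ω)` is complete as a closed subspace, the form is coercive
by a fractional Poincaré inequality (`HZero.poincare`), and `V` is dense in `L²(Ω)` because it
contains the test functions (`memLp_diffQuot`).
-/

noncomputable section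

set_option linter.unusedSectionVars false

namespace FracHeat

/-! ### Primitives of vector-valued functions -/

section Primitives

variable {X Y Z : Type*} [NormedAddCommGroup X] [NormedSpace ℝ X] [CompleteSpace X]
  [NormedAddCommGroup Y] [NormedSpace ℝ Y] [CompleteSpace Y]
  [NormedAddCommGroup Z] [NormedSpace ℝ Z] [CompleteSpace Z]

/-- Fubini's theorem on the square `(a,b]²`, cut along its diagonal. -/
theorem bilin_integral_eq_add (L : X →L[ℝ] Y →L[ℝ] Z) {a b : ℝ} (hab : a ≤ b) {v : ℝ → X}
    {w : ℝ → Y} (hv : IntegrableOn v (Ioc a b)) (hw : IntegrableOn w (Ioc a b)) :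
    IntegrableOn (fun t => L (v t) (∫ r in a..t, w r)) (Ioc a b) ∧
    IntegrableOn (fun t => L (∫ r in a..t, v r) (w t)) (Ioc a b) ∧
    L (∫ r in a..b, v r) (∫ r in a..b, w r) =
      (∫ t in a..b, L (v t) (∫ r in a..t, w r)) + ∫ t in a..b, L (∫ r in a..t, v r) (w t) := by
  set μ : Measure ℝ := volume.restrict (Ioc a b) with hμ
  have hF : Integrable (fun z : ℝ × ℝ => L (v z.1) (w z.2)) (μ.prod μ) :=
    hv.op_fst_snd (by fun_prop) ⟨‖L‖, L.le_opNorm₂⟩ hw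
  have hD : MeasurableSet {z : ℝ × ℝ | z.2 ≤ z.1} := measurableSet_le measurable_snd measurable_fst
  have hF1 := hF.indicator hD
  have hF2 := hF.indicator hD.compl
  have e1 : ∀ t ∈ Ioc a b, (∫ s, indicator {z : ℝ × ℝ | z.2 ≤ z.1}
      (fun z : ℝ × ℝ => L (v z.1) (w z.2)) (t, s) ∂μ) = L (v t) (∫ r in a..t, w r) := by
    intro t ht
    have : (fun s => indicator {z : ℝ × ℝ | z.2 ≤ z.1}
        (fun z : ℝ × ℝ => L (v z.1) (w z.2)) (t, s)) =
        indicator (Iic t) (fun s => L (v t) (w s)) := by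
      ext s; simp [indicator]
    rw [this, integral_indicator measurableSet_Iic, hμ, Measure.restrict_restrict measurableSet_Iic,
      intervalIntegral.integral_of_le ht.1.le]
    have hset : Iic t ∩ Ioc a b = Ioc a t := by
      ext x
      simp only [mem_inter_iff, mem_Iic, mem_Ioc]
      grind
    rw [hset, ContinuousLinearMap.integral_comp_comm]
    exact hw.mono_set (Ioc_subset_Ioc_right ht.2)
  have e2 : ∀ s ∈ Ioc a b, (∫ t, indicator {z : ℝ × ℝ | z.2 ≤ z.1}ᶜ
      (fun z : ℝ × ℝ => L (v z.1) (w z.2)) (t, s) ∂μ) = L (∫ r in a..s, v r) (w s) := by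
    intro s hs
    have : (fun t => indicator {z : ℝ × ℝ | z.2 ≤ z.1}ᶜ
        (fun z : ℝ × ℝ => L (v z.1) (w z.2)) (t, s)) =
        indicator (Iio s) (fun t => L.flip (w s) (v t)) := by
      ext t; simp [indicator]
    rw [this, integral_indicator measurableSet_Iio, hμ, Measure.restrict_restrict measurableSet_Iio,
      intervalIntegral.integral_of_le hs.1.le, integral_Ioc_eq_integral_Ioo]
    have hset : Iio s ∩ Ioc a b = Ioo a s := by
      ext x
      simp only [mem_inter_iff, mem_Iio, mem_Ioc, mem_Ioo]
      grind
    rw [hset, ContinuousLinearMap.integral_comp_comm]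
    · rfl
    · exact hv.mono_set (Ioo_subset_Ioc_self.trans (Ioc_subset_Ioc_right hs.2))
  have a1 : (fun t => ∫ s, indicator {z : ℝ × ℝ | z.2 ≤ z.1}
      (fun z : ℝ × ℝ => L (v z.1) (w z.2)) (t, s) ∂μ) =ᵐ[μ]
      fun t => L (v t) (∫ r in a..t, w r) :=
    (ae_restrict_iff' measurableSet_Ioc).2 (.of_forall e1)
  have a2 : (fun s => ∫ t, indicator {z : ℝ × ℝ | z.2 ≤ z.1}ᶜ
      (fun z : ℝ × ℝ => L (v z.1) (w z.2)) (t, s) ∂μ) =ᵐ[μ]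
      fun s => L (∫ r in a..s, v r) (w s) :=
    (ae_restrict_iff' measurableSet_Ioc).2 (.of_forall e2)
  refine ⟨hF1.integral_prod_left.congr a1, hF2.integral_prod_right.congr a2, ?_⟩
  simp only [intervalIntegral.integral_of_le hab]
  rw [← integral_congr_ae a1, ← integral_congr_ae a2, ← integral_prod _ hF1,
    ← integral_prod_symm _ hF2, ← integral_add hF1 hF2, ← integral_prod_bilin L hv hw]
  congr 1
  ext z
  by_cases h : z ∈ {z : ℝ × ℝ | z.2 ≤ z.1} <;> simp [h]

/-- Integration by parts for two primitives and a bounded bilinear map. -/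
theorem bilin_primitive_sub (L : X →L[ℝ] Y →L[ℝ] Z) {a b : ℝ} (hab : a ≤ b) {v : ℝ → X}
    {w : ℝ → Y} (hv : IntegrableOn v (Ioc a b)) (hw : IntegrableOn w (Ioc a b)) (x : X) (y : Y) :
    IntegrableOn (fun t => L (v t) (y + ∫ r in a..t, w r)) (Ioc a b) ∧
    IntegrableOn (fun t => L (x + ∫ r in a..t, v r) (w t)) (Ioc a b) ∧
    L (x + ∫ r in a..b, v r) (y + ∫ r in a..b, w r) - L x y =
      (∫ t in a..b, L (v t) (y + ∫ r in a..t, w r)) +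
        ∫ t in a..b, L (x + ∫ r in a..t, v r) (w t) := by
  obtain ⟨h1, h2, h3⟩ := bilin_integral_eq_add L hab hv hw
  have h4 : IntegrableOn (fun t => L (v t) y) (Ioc a b) := (L.flip y).integrable_comp hv
  have h5 : IntegrableOn (fun t => L x (w t)) (Ioc a b) := (L x).integrable_comp hw
  have e4 : ∫ t in a..b, L (v t) y = L (∫ t in a..b, v t) y := by
    simp only [intervalIntegral.integral_of_le hab]
    exact (L.flip y).integral_comp_comm hv
  have e5 : ∫ t in a..b, L x (w t) = L x (∫ t in a..b, w t) := by
    simp only [intervalIntegral.integral_of_le hab]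
    exact (L x).integral_comp_comm hw
  refine ⟨?_, ?_, ?_⟩
  · simpa only [map_add, Pi.add_def] using h4.add h1
  · simpa only [map_add, add_apply, Pi.add_def] using h5.add h2
  · have i4 := (intervalIntegrable_iff_integrableOn_Ioc_of_le hab).2 h4
    have i5 := (intervalIntegrable_iff_integrableOn_Ioc_of_le hab).2 h5
    have i1 := (intervalIntegrable_iff_integrableOn_Ioc_of_le hab).2 h1
    have i2 := (intervalIntegrable_iff_integrableOn_Ioc_of_le hab).2 h2
    simp only [map_add, add_apply]
    rw [intervalIntegral.integral_add i4 i1, intervalIntegral.integral_add i5 i2, e4, e5, h3]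
    abel

/-- A function that vanishes after integration over all `(0,t)` vanishes almost everywhere. -/
theorem ae_eq_zero_of_primitive_eq_zero {b : ℝ} (hb : 0 ≤ b) {v : ℝ → X}
    (hv : IntegrableOn v (Ioc 0 b)) (h : ∀ t ∈ Icc 0 b, ∫ r in 0..t, v r = 0) :
    ∀ᵐ t ∂volume.restrict (Ioo 0 b), v t = 0 := by
  rw [ae_restrict_iff' measurableSet_Ioo]
  have hi := (intervalIntegrable_iff_integrableOn_Ioc_of_le hb).2 hv
  filter_upwards [hi.ae_hasDerivAt_integral] with t ht hmem
  rw [uIcc_of_le hb] at ht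
  have h1 := ht (Ioo_subset_Icc_self hmem) 0 (left_mem_Icc.2 hb)
  have h2 : (fun x => ∫ r in 0..x, v r) =ᶠ[nhds t] fun _ => 0 := by
    filter_upwards [isOpen_Ioo.mem_nhds hmem] with x hx using h x (Ioo_subset_Icc_self hx)
  exact h1.unique ((hasDerivAt_const t (0 : X)).congr_of_eventuallyEq h2)

/-- The lemma of du Bois-Reymond: a continuous function on `[0,b]` whose weak derivative vanishes
is constant. -/
theorem eq_of_weak_deriv_eq_zero {b : ℝ} (hb : 0 < b) {g : ℝ → X} (hg : ContinuousOn g (Icc 0 b))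
    (h : ∀ η : ℝ → ℝ, ContDiff ℝ (⊤ : ℕ∞) η → HasCompactSupport η → tsupport η ⊆ Ioo 0 b →
      ∫ t in Ioo 0 b, deriv η t • g t = 0) :
    ∀ t ∈ Icc 0 b, g t = g 0 := by
  have hgi : IntegrableOn g (Ioo 0 b) := (hg.integrableOn_Icc).mono_set Ioo_subset_Icc_self
  -- a bump function of integral one supported in `(0,b)`
  let ρ₀ : ContDiffBump (b / 2) := ⟨b / 8, b / 4, by positivity, by linarith⟩
  set ρ : ℝ → ℝ := ρ₀.normed volume with hρ
  have hρc : ContDiff ℝ (⊤ : ℕ∞) ρ := ρ₀.contDiff_normed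
  have hρs : tsupport ρ ⊆ Icc (b / 4) (3 * b / 4) := by
    rw [hρ, ρ₀.tsupport_normed_eq]
    intro x hx
    rw [Metric.mem_closedBall, Real.dist_eq, abs_le] at hx
    constructor <;> [(have := hx.1); (have := hx.2)] <;> simp only [ρ₀] at this <;> linarith
  have hρ1 : ∫ t, ρ t = 1 := ρ₀.integral_normed
  set c : X := ∫ t in Ioo 0 b, ρ t • g t with hc
  have key : ∀ᵐ t, t ∈ Ioo 0 b → g t - c = 0 := by
    refine isOpen_Ioo.ae_eq_zero_of_integral_contDiff_smul_eq_zero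
      ((hgi.locallyIntegrableOn).sub (locallyIntegrable_const c |>.locallyIntegrableOn _)) ?_
    intro ψ hψ hψc hψs
    have hψi : Integrable ψ := hψ.continuous.integrable_of_hasCompactSupport hψc
    have hρi : Integrable ρ := ρ₀.integrable_normed
    set m : ℝ := ∫ t, ψ t with hm
    -- the test function `η` is the primitive of `ψ - m ρ`
    let f : ℝ → ℝ := fun t => ψ t - m * ρ t
    have hfc : ContDiff ℝ (⊤ : ℕ∞) f := hψ.sub (contDiff_const.mul hρc)
    have hfi : Integrable f := hψi.sub (hρi.const_mul m)
    have hf0 : ∫ t, f t = 0 := by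
      simp only [f]
      rw [integral_sub hψi (hρi.const_mul m), integral_const_mul, hρ1, mul_one, sub_self]
    have hsupp : ∃ α β, 0 < α ∧ β < b ∧ ∀ t, t ∉ Icc α β → f t = 0 := by
      obtain ⟨α, β, hα, hβ, hαβ⟩ : ∃ α β, 0 < α ∧ β < b ∧ tsupport ψ ⊆ Icc α β := by
        by_cases hne : (tsupport ψ).Nonempty
        · exact ⟨sInf (tsupport ψ), sSup (tsupport ψ),
            (hψs (hψc.isCompact.sInf_mem hne)).1, (hψs (hψc.isCompact.sSup_mem hne)).2,
            fun x hx => ⟨csInf_le hψc.isCompact.bddBelow hx, le_csSup hψc.isCompact.bddAbove hx⟩⟩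
        · rw [not_nonempty_iff_eq_empty] at hne
          exact ⟨b / 2, b / 2, by linarith, by linarith, by simp [hne]⟩
      refine ⟨min α (b / 4), max β (3 * b / 4), by positivity, max_lt hβ (by linarith), ?_⟩
      intro t ht
      have h1 : ψ t = 0 := image_eq_zero_of_notMem_tsupport fun hh => ht
        ⟨(min_le_left _ _).trans (hαβ hh).1, (hαβ hh).2.trans (le_max_left _ _)⟩
      have h2 : ρ t = 0 := image_eq_zero_of_notMem_tsupport fun hh => ht
        ⟨(min_le_right _ _).trans (hρs hh).1, (hρs hh).2.trans (le_max_right _ _)⟩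
      simp [f, h1, h2]
    obtain ⟨α, β, hα, hβ, hfs⟩ := hsupp
    let η : ℝ → ℝ := fun t => ∫ r in 0..t, f r
    have hder : ∀ t, HasDerivAt η (f t) t := fun t =>
      hfc.continuous.integral_hasStrictDerivAt 0 t |>.hasDerivAt
    have hdη : deriv η = f := funext fun t => (hder t).deriv
    have hηc : ContDiff ℝ (⊤ : ℕ∞) η := by
      rw [contDiff_infty_iff_deriv]
      exact ⟨fun t => (hder t).differentiableAt, by rw [hdη]; exact hfc⟩
    have hη0 : ∀ t, t ∉ Icc α β → η t = 0 := by
      intro t ht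
      by_cases htα : t < α
      · have : EqOn f 0 (uIcc 0 t) := by
          intro r hr
          refine hfs r fun hr' => ?_
          have := (mem_uIcc.1 hr)
          rcases this with h | h <;> linarith [hr'.1, h.1, h.2]
        simp only [η]
        rw [intervalIntegral.integral_congr this]
        simp
      · have htβ : β < t := by
          by_contra hcon
          exact ht ⟨not_lt.1 htα, not_lt.1 hcon⟩
        have e1 : ∫ r in Iic 0, f r = 0 := by
          rw [setIntegral_congr_fun measurableSet_Iic (g := fun _ => 0)]
          · simp
          · intro r hr
            exact hfs r fun hr' => by linarith [hr'.1, mem_Iic.1 hr]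
        have e2 : ∫ r in Ioi t, f r = 0 := by
          rw [setIntegral_congr_fun measurableSet_Ioi (g := fun _ => 0)]
          · simp
          · intro r hr
            exact hfs r fun hr' => by linarith [hr'.2, mem_Ioi.1 hr]
        have e3 := intervalIntegral.integral_Iic_add_Ioi (b := t) hfi.integrableOn hfi.integrableOn
        have e4 := intervalIntegral.integral_Iic_sub_Iic (a := (0 : ℝ)) (b := t)
          hfi.integrableOn hfi.integrableOn
        simp only [η]
        rw [← e4, e1, sub_zero]
        linarith
    have hηs : tsupport η ⊆ Icc α β :=
      closure_minimal (fun t ht => by_contra fun hh => ht (hη0 t hh)) isClosed_Icc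
    have hmain := h η hηc (HasCompactSupport.of_support_subset_isCompact isCompact_Icc
      (subset_closure.trans hηs)) (hηs.trans fun x hx => ⟨hα.trans_le hx.1, hx.2.trans_lt hβ⟩)
    rw [hdη] at hmain
    have hψg : IntegrableOn (fun t => ψ t • g t) (Ioo 0 b) := by
      refine (ContinuousOn.integrableOn_Icc ?_).mono_set Ioo_subset_Icc_self
      exact hψ.continuous.continuousOn.smul hg
    have hρg : IntegrableOn (fun t => ρ t • g t) (Ioo 0 b) := by
      refine (ContinuousOn.integrableOn_Icc ?_).mono_set Ioo_subset_Icc_self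
      exact hρc.continuous.continuousOn.smul hg
    have e5 : ∫ t in Ioo 0 b, ψ t • g t = m • c := by
      have : ∫ t in Ioo 0 b, f t • g t =
          (∫ t in Ioo 0 b, ψ t • g t) - m • ∫ t in Ioo 0 b, ρ t • g t := by
        have e := integral_sub hψg (hρg.smul m)
        simp only [Pi.smul_apply, integral_smul] at e
        rw [← e]
        simp only [f, sub_smul, mul_smul]
      rw [this, sub_eq_zero] at hmain
      rw [hmain]
    have e6 : ∫ t, ψ t • (g t - c) = ∫ t in Ioo 0 b, ψ t • (g t - c) := by
      rw [setIntegral_eq_integral_of_forall_compl_eq_zero]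
      intro t ht
      rw [image_eq_zero_of_notMem_tsupport (fun hh => ht (hψs hh)), zero_smul]
    have e7 : ∫ t in Ioo 0 b, ψ t • c = m • c := by
      rw [integral_smul_const, setIntegral_eq_integral_of_forall_compl_eq_zero]
      intro t ht
      exact image_eq_zero_of_notMem_tsupport (fun hh => ht (hψs hh))
    rw [e6]
    simp only [smul_sub]
    rw [integral_sub hψg (hψi.integrableOn.smul_const c), e5, e7, sub_self]
  have hcons : EqOn g (fun _ => c) (Icc 0 b) := by
    have h1 : EqOn g (fun _ => c) (Ioo 0 b) := by
      have : g =ᵐ[volume.restrict (Ioo 0 b)] fun _ => c := by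
        rw [Filter.EventuallyEq, ae_restrict_iff' measurableSet_Ioo]
        filter_upwards [key] with t ht hmem using sub_eq_zero.1 (ht hmem)
      exact Measure.eqOn_open_of_ae_eq this isOpen_Ioo (hg.mono Ioo_subset_Icc_self)
        continuousOn_const
    refine h1.of_subset_closure hg continuousOn_const Ioo_subset_Icc_self ?_
    rw [closure_Ioo hb.ne]
  intro t ht
  rw [hcons ht, hcons (left_mem_Icc.2 hb.le)]

omit [CompleteSpace X] in
theorem integral_Ioo_eq_interval {b : ℝ} (hb : 0 ≤ b) (f : ℝ → X) :
    ∫ t in Ioo 0 b, f t = ∫ t in 0..b, f t := by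
  rw [intervalIntegral.integral_of_le hb, integral_Ioc_eq_integral_Ioo]

/-- The primitive of `v` has the weak derivative `v`. -/
theorem weak_deriv_primitive {b : ℝ} (hb : 0 ≤ b) {v : ℝ → X} (hv : IntegrableOn v (Ioc 0 b))
    (x : X) {η : ℝ → ℝ} (hη : ContDiff ℝ (⊤ : ℕ∞) η) (hηs : tsupport η ⊆ Ioo 0 b) :
    ∫ t in Ioo 0 b, deriv η t • (x + ∫ r in 0..t, v r) = -∫ t in Ioo 0 b, η t • v t := by
  have hη0 : ∀ t, t ∉ Ioo 0 b → η t = 0 := fun t ht =>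
    image_eq_zero_of_notMem_tsupport fun hh => ht (hηs hh)
  have hdc : Continuous (deriv η) := hη.continuous_deriv (by simp)
  have hprim : ∀ t, (0 : ℝ) + ∫ r in 0..t, deriv η r = η t := by
    intro t
    rw [intervalIntegral.integral_deriv_eq_sub
      (fun _ _ => (hη.differentiable (by simp)).differentiableAt)
      (hdc.intervalIntegrable _ _), hη0 0 (by simp)]
    ring
  obtain ⟨-, -, h⟩ := bilin_primitive_sub (ContinuousLinearMap.lsmul ℝ ℝ (E := X)) hb
    (v := deriv η) (w := v) (hdc.integrableOn_Ioc) hv 0 x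
  simp only [hprim, ContinuousLinearMap.lsmul_apply, zero_smul, sub_zero, hη0 b (by simp)] at h
  rw [integral_Ioo_eq_interval hb, integral_Ioo_eq_interval hb]
  exact eq_neg_of_add_eq_zero_left h.symm

/-- A continuous function with an integrable weak derivative is a primitive of it. -/
theorem eq_add_integral_of_weak_deriv {b : ℝ} (hb : 0 < b) {u v : ℝ → X}
    (hu : ContinuousOn u (Icc 0 b)) (hv : IntegrableOn v (Ioc 0 b))
    (h : ∀ η : ℝ → ℝ, ContDiff ℝ (⊤ : ℕ∞) η → HasCompactSupport η → tsupport η ⊆ Ioo 0 b →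
      ∫ t in Ioo 0 b, deriv η t • u t = -∫ t in Ioo 0 b, η t • v t) :
    ∀ t ∈ Icc 0 b, u t = u 0 + ∫ r in 0..t, v r := by
  have hP : ContinuousOn (fun t => ∫ r in 0..t, v r) (Icc 0 b) := by
    have := intervalIntegral.continuousOn_primitive_interval' (a := 0) (b₁ := 0) (b₂ := b)
      (f := v) (μ := volume) ((intervalIntegrable_iff_integrableOn_Ioc_of_le hb.le).2 hv)
      left_mem_uIcc
    rwa [uIcc_of_le hb.le] at this
  intro t ht
  have := eq_of_weak_deriv_eq_zero hb
    (g := fun t => u t - ∫ r in 0..t, v r) (hu.sub hP) ?_ t ht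
  · simp only [intervalIntegral.integral_same, sub_zero] at this
    rw [← this, sub_add_cancel]
  · intro η hη hηc hηs
    have hdc : Continuous (deriv η) := hη.continuous_deriv (by simp)
    have h1 := weak_deriv_primitive hb.le hv 0 hη hηs
    simp only [zero_add] at h1
    simp only [smul_sub]
    rw [integral_sub, h η hη hηc hηs, h1, sub_self]
    · exact ((hdc.continuousOn.smul hu).integrableOn_Icc).mono_set Ioo_subset_Icc_self
    · exact ((hdc.continuousOn.smul hP).integrableOn_Icc).mono_set Ioo_subset_Icc_self

end Primitives

/-! ### Trajectories of an abstract parabolic equation -/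

section Evolution

open Filter Topology RealInnerProductSpace

variable {V H : Type*} [NormedAddCommGroup V] [InnerProductSpace ℝ V] [CompleteSpace V]
  [NormedAddCommGroup H] [InnerProductSpace ℝ H] [CompleteSpace H]

/-- The space `L²(0,τ; X)`. -/
abbrev TimeL2 (τ : ℝ) (X : Type*) [NormedAddCommGroup X] : Type _ :=
  Lp X 2 (volume.restrict (Ioo (0 : ℝ) τ))

theorem integrableOn_Ioc_of_memLp {X : Type*} [NormedAddCommGroup X] {τ : ℝ} {v : ℝ → X}
    (hv : MemLp v 2 (volume.restrict (Ioo 0 τ))) : IntegrableOn v (Ioc 0 τ) := by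
  have : IntegrableOn v (Ioo 0 τ) := hv.integrable one_le_two
  exact (integrableOn_Ioc_iff_integrableOn_Ioo).2 this

theorem TimeL2.integrableOn {X : Type*} [NormedAddCommGroup X] {τ : ℝ} (v : TimeL2 τ X) {t : ℝ}
    (ht : t ≤ τ) : IntegrableOn v (Ioc 0 t) :=
  (integrableOn_Ioc_of_memLp (Lp.memLp v)).mono_set (Ioc_subset_Ioc_right ht)

theorem TimeL2.intervalIntegrable {X : Type*} [NormedAddCommGroup X] {τ : ℝ} (v : TimeL2 τ X)
    {t : ℝ} (ht : t ∈ Icc 0 τ) : IntervalIntegrable v volume 0 t :=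
  (intervalIntegrable_iff_integrableOn_Ioc_of_le ht.1).2 (v.integrableOn ht.2)

/-- The trajectory `t ↦ a + ∫₀ᵗ v` with initial point `a` and velocity `v`. -/
def traj {τ : ℝ} (a : V) (v : TimeL2 τ V) (t : ℝ) : V := a + ∫ r in 0..t, v r

theorem continuousOn_traj {τ : ℝ} (hτ : 0 ≤ τ) (a : V) (v : TimeL2 τ V) :
    ContinuousOn (traj a v) (Icc 0 τ) := by
  have := intervalIntegral.continuousOn_primitive_interval' (a := 0)
    (v.intervalIntegrable (right_mem_Icc.2 hτ)) left_mem_uIcc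
  rw [uIcc_of_le hτ] at this
  exact continuousOn_const.add this

theorem memLp_of_continuousOn {X : Type*} [NormedAddCommGroup X] {τ : ℝ} {u : ℝ → X}
    (hu : ContinuousOn u (Icc 0 τ)) : MemLp u 2 (volume.restrict (Ioo 0 τ)) := by
  obtain ⟨C, hC⟩ := isCompact_Icc.exists_bound_of_continuousOn hu
  refine MemLp.of_bound ((hu.mono Ioo_subset_Icc_self).aestronglyMeasurable measurableSet_Ioo) C ?_
  filter_upwards [ae_restrict_mem measurableSet_Ioo] with t ht using hC t (Ioo_subset_Icc_self ht)

theorem memLp_traj {τ : ℝ} (hτ : 0 ≤ τ) (a : V) (v : TimeL2 τ V) :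
    MemLp (traj a v) 2 (volume.restrict (Ioo 0 τ)) :=
  memLp_of_continuousOn (continuousOn_traj hτ a v)

theorem traj_add {τ : ℝ} (a b : V) (v w : TimeL2 τ V) {t : ℝ} (ht : t ∈ Icc 0 τ) :
    traj (a + b) (v + w) t = traj a v t + traj b w t := by
  have : ∫ r in 0..t, (v + w) r = ∫ r in 0..t, (v r + w r) := by
    rw [intervalIntegral.integral_of_le ht.1, intervalIntegral.integral_of_le ht.1]
    refine integral_congr_ae ?_
    rw [Measure.restrict_congr_set Ioo_ae_eq_Ioc.symm]
    exact ae_restrict_of_ae_restrict_of_subset (Ioo_subset_Ioo_right ht.2) (Lp.coeFn_add v w)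
  rw [traj, traj, traj, this, intervalIntegral.integral_add (v.intervalIntegrable ht)
    (w.intervalIntegrable ht)]
  abel

theorem traj_smul {τ : ℝ} (k : ℝ) (a : V) (v : TimeL2 τ V) {t : ℝ} (ht : t ∈ Icc 0 τ) :
    traj (k • a) (k • v) t = k • traj a v t := by
  have : ∫ r in 0..t, (k • v) r = ∫ r in 0..t, k • v r := by
    rw [intervalIntegral.integral_of_le ht.1, intervalIntegral.integral_of_le ht.1]
    refine integral_congr_ae ?_
    rw [Measure.restrict_congr_set Ioo_ae_eq_Ioc.symm]
    exact ae_restrict_of_ae_restrict_of_subset (Ioo_subset_Ioo_right ht.2) (Lp.coeFn_smul k v)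
  rw [traj, traj, this, intervalIntegral.integral_smul, smul_add]

/-- A trajectory as an element of `L²(0,τ; V)`, linearly in its initial point and velocity. -/
def trajL2 {τ : ℝ} (hτ : 0 ≤ τ) : V × TimeL2 τ V →ₗ[ℝ] TimeL2 τ V where
  toFun z := (memLp_traj hτ z.1 z.2).toLp
  map_add' z z' := by
    rw [← MemLp.toLp_add]
    refine MemLp.toLp_congr _ _ ?_
    filter_upwards [ae_restrict_mem measurableSet_Ioo] with t ht
    exact traj_add _ _ _ _ (Ioo_subset_Icc_self ht)
  map_smul' k z := by
    rw [RingHom.id_apply, ← MemLp.toLp_const_smul]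
    refine MemLp.toLp_congr _ _ ?_
    filter_upwards [ae_restrict_mem measurableSet_Ioo] with t ht
    exact traj_smul _ _ _ (Ioo_subset_Icc_self ht)

theorem coeFn_trajL2 {τ : ℝ} (hτ : 0 ≤ τ) (z : V × TimeL2 τ V) :
    trajL2 hτ z =ᵐ[volume.restrict (Ioo 0 τ)] traj z.1 z.2 :=
  MemLp.coeFn_toLp (memLp_traj hτ z.1 z.2)

/-- The operator `ι†ι` on `V`, which represents the inner product of `H`. -/
def gram (ι : V →L[ℝ] H) : V →L[ℝ] V := ι.adjoint.comp ι

theorem inner_gram_left (ι : V →L[ℝ] H) (x y : V) : ⟪gram ι x, y⟫ = ⟪ι x, ι y⟫ := by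
  rw [gram, ContinuousLinearMap.comp_apply, ContinuousLinearMap.adjoint_inner_left]

/-- The source `ι†ι v + B w` of the equation solved by the trajectory `w = a + ∫₀ v`. It is the
representative in `V`, by the Riesz theorem, of the functional `w_t + B w ∈ V'`. -/
def source {τ : ℝ} (hτ : 0 ≤ τ) (ι : V →L[ℝ] H) (B : V →L[ℝ] V) :
    V × TimeL2 τ V →ₗ[ℝ] TimeL2 τ V :=
  ((gram ι).compLpL 2 _).toLinearMap ∘ₗ LinearMap.snd ℝ _ _ +
    (B.compLpL 2 _).toLinearMap ∘ₗ trajL2 hτ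

theorem coeFn_source {τ : ℝ} (hτ : 0 ≤ τ) (ι : V →L[ℝ] H) (B : V →L[ℝ] V)
    (z : V × TimeL2 τ V) : source hτ ι B z =ᵐ[volume.restrict (Ioo 0 τ)]
      fun t => gram ι (z.2 t) + B (traj z.1 z.2 t) := by
  have h : source hτ ι B z = (gram ι).compLpL 2 _ z.2 + B.compLpL 2 _ (trajL2 hτ z) := rfl
  rw [h]
  filter_upwards [Lp.coeFn_add ((gram ι).compLpL 2 _ z.2) (B.compLpL 2 _ (trajL2 hτ z)),
    (gram ι).coeFn_compLpL z.2, B.coeFn_compLpL (trajL2 hτ z), coeFn_trajL2 hτ z]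
    with t h1 h2 h3 h4
  rw [h1, Pi.add_apply, h2, h3, h4]

theorem TimeL2.norm_sq {X : Type*} [NormedAddCommGroup X] [InnerProductSpace ℝ X] {τ : ℝ}
    (v : TimeL2 τ X) : ‖v‖ ^ 2 = ∫ t in Ioo 0 τ, ‖v t‖ ^ 2 := by
  rw [← real_inner_self_eq_norm_sq, L2.inner_def]
  simp only [real_inner_self_eq_norm_sq]

theorem TimeL2.integrable_norm_sq {X : Type*} [NormedAddCommGroup X]
    {τ : ℝ} (v : TimeL2 τ X) : Integrable (fun t => ‖v t‖ ^ 2) (volume.restrict (Ioo 0 τ)) :=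
  (memLp_two_iff_integrable_sq_norm (Lp.memLp v).1).1 (Lp.memLp v)

/-- The energy estimate for the equation `w_t + B w = f` with a coercive `B`. -/
theorem energy_estimate {τ : ℝ} (hτ : 0 ≤ τ) (ι : V →L[ℝ] H) (B : V →L[ℝ] V) {c : ℝ} (hc : 0 < c)
    (hB : ∀ x, c * ‖x‖ ^ 2 ≤ ⟪B x, x⟫) (z : V × TimeL2 τ V) {t : ℝ} (ht : t ∈ Icc 0 τ) :
    ‖ι (traj z.1 z.2 t)‖ ^ 2 + c * ∫ r in Ioo 0 t, ‖traj z.1 z.2 r‖ ^ 2 ≤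
      ‖ι z.1‖ ^ 2 + c⁻¹ * ‖source hτ ι B z‖ ^ 2 := by
  set w := traj z.1 z.2 with hw
  set f := source hτ ι B z with hf
  set L : V →L[ℝ] V →L[ℝ] ℝ := (innerSL ℝ : H →L[ℝ] H →L[ℝ] ℝ).bilinearComp ι ι with hL
  have hLa : ∀ x y, L x y = ⟪ι x, ι y⟫ := fun x y => rfl
  obtain ⟨i1, i2, h3⟩ := bilin_primitive_sub L ht.1 (z.2.integrableOn ht.2)
    (z.2.integrableOn ht.2) z.1 z.1
  change IntegrableOn (fun t => L (z.2 t) (w t)) _ at i1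
  change IntegrableOn (fun t => L (w t) (z.2 t)) _ at i2
  change L (w t) (w t) - L z.1 z.1 = (∫ t in 0..t, L (z.2 t) (w t)) +
    ∫ t in 0..t, L (w t) (z.2 t) at h3
  rw [← integral_Ioo_eq_interval ht.1, ← integral_Ioo_eq_interval ht.1,
    ← integral_add (i1.mono_set Ioo_subset_Ioc_self) (i2.mono_set Ioo_subset_Ioc_self),
    hLa, hLa, real_inner_self_eq_norm_sq, real_inner_self_eq_norm_sq] at h3
  have hwi : IntegrableOn (fun r => ‖w r‖ ^ 2) (Ioo 0 t) :=
    (((continuousOn_traj hτ z.1 z.2).mono (Icc_subset_Icc_right ht.2)).norm.pow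
      2).integrableOn_Icc.mono_set Ioo_subset_Icc_self
  have hfi : IntegrableOn (fun r => ‖f r‖ ^ 2) (Ioo 0 τ) := f.integrable_norm_sq
  have hle : ∫ r in Ioo 0 t, (L (z.2 r) (w r) + L (w r) (z.2 r)) ≤
      ∫ r in Ioo 0 t, (c⁻¹ * ‖f r‖ ^ 2 - c * ‖w r‖ ^ 2) := by
    refine integral_mono_ae ((i1.mono_set Ioo_subset_Ioc_self).add
      (i2.mono_set Ioo_subset_Ioc_self)) (((hfi.mono_set (Ioo_subset_Ioo_right ht.2)).const_mul
        _).sub (hwi.const_mul _)) ?_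
    filter_upwards [ae_restrict_of_ae_restrict_of_subset (Ioo_subset_Ioo_right ht.2)
      (coeFn_source hτ ι B z)] with r hr
    have e1 : L (z.2 r) (w r) = ⟪f r, w r⟫ - ⟪B (w r), w r⟫ := by
      rw [hr, inner_add_left, inner_gram_left, hLa]; ring
    have e2 : L (w r) (z.2 r) = L (z.2 r) (w r) := by rw [hLa, hLa, real_inner_comm]
    have e3 := real_inner_le_norm (f r) (w r)
    have e4 := hB (w r)
    have e5 : 2 * (‖f r‖ * ‖w r‖) ≤ c⁻¹ * ‖f r‖ ^ 2 + c * ‖w r‖ ^ 2 := by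
      have : 0 ≤ c⁻¹ * (‖f r‖ - c * ‖w r‖) ^ 2 := by positivity
      have e6 : c⁻¹ * (‖f r‖ - c * ‖w r‖) ^ 2 =
          c⁻¹ * ‖f r‖ ^ 2 - 2 * (‖f r‖ * ‖w r‖) + c * ‖w r‖ ^ 2 := by
        field_simp; ring
      linarith
    rw [e2, e1]
    linarith
  rw [integral_sub ((hfi.mono_set (Ioo_subset_Ioo_right ht.2)).const_mul _) (hwi.const_mul _),
    integral_const_mul, integral_const_mul] at hle
  have hff : ∫ r in Ioo 0 t, ‖f r‖ ^ 2 ≤ ‖f‖ ^ 2 := by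
    rw [f.norm_sq]
    exact setIntegral_mono_set hfi (.of_forall fun _ => by positivity)
      (Ioo_subset_Ioo_right ht.2).eventuallyLE
  have := mul_le_mul_of_nonneg_left hff (inv_pos.2 hc).le
  linarith

theorem norm_sq_apply_traj_le {τ : ℝ} (hτ : 0 ≤ τ) (ι : V →L[ℝ] H) (B : V →L[ℝ] V) {c : ℝ}
    (hc : 0 < c) (hB : ∀ x, c * ‖x‖ ^ 2 ≤ ⟪B x, x⟫) (z : V × TimeL2 τ V) {t : ℝ}
    (ht : t ∈ Icc 0 τ) :
    ‖ι (traj z.1 z.2 t)‖ ^ 2 ≤ ‖ι z.1‖ ^ 2 + c⁻¹ * ‖source hτ ι B z‖ ^ 2 := by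
  have h := energy_estimate hτ ι B hc hB z ht
  have : 0 ≤ c * ∫ r in Ioo 0 t, ‖traj z.1 z.2 r‖ ^ 2 :=
    mul_nonneg hc.le (integral_nonneg fun _ => by positivity)
  linarith

theorem norm_sq_trajL2_le {τ : ℝ} (hτ : 0 ≤ τ) (ι : V →L[ℝ] H) (B : V →L[ℝ] V) {c : ℝ}
    (hc : 0 < c) (hB : ∀ x, c * ‖x‖ ^ 2 ≤ ⟪B x, x⟫) (z : V × TimeL2 τ V) :
    c * ‖trajL2 hτ z‖ ^ 2 ≤ ‖ι z.1‖ ^ 2 + c⁻¹ * ‖source hτ ι B z‖ ^ 2 := by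
  have h := energy_estimate hτ ι B hc hB z (right_mem_Icc.2 hτ)
  have e : ‖trajL2 hτ z‖ ^ 2 = ∫ r in Ioo 0 τ, ‖traj z.1 z.2 r‖ ^ 2 := by
    rw [TimeL2.norm_sq]
    refine integral_congr_ae ?_
    filter_upwards [coeFn_trajL2 hτ z] with r hr
    rw [hr]
  rw [e]
  have := sq_nonneg ‖ι (traj z.1 z.2 τ)‖
  linarith

/-- The sources of the trajectories that start at `0` are dense in `L²(0,τ; V)`. If `φ` is
orthogonal to all of them, then `θ(t) = ∫ₜ^τ φ` solves the homogeneous adjoint equation with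
terminal value `0`, in the sense that testing with the velocity `θ` gives
`½ ‖ι θ(0)‖² + ∫ ⟪B θ, θ⟫ = 0`; so `θ`, and with it `φ`, vanishes. -/
theorem dense_range_source {τ : ℝ} (hτ : 0 ≤ τ) (ι : V →L[ℝ] H) (B : V →L[ℝ] V) {c : ℝ}
    (hc : 0 < c) (hB : ∀ x, c * ‖x‖ ^ 2 ≤ ⟪B x, x⟫) :
    DenseRange fun v : TimeL2 τ V => source hτ ι B (0, v) := by
  set T : TimeL2 τ V →ₗ[ℝ] TimeL2 τ V := source hτ ι B ∘ₗ LinearMap.inr ℝ _ _ with hT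
  suffices h : (LinearMap.range T).topologicalClosure = ⊤ by
    have : Dense (LinearMap.range T : Set (TimeL2 τ V)) :=
      Submodule.dense_iff_topologicalClosure_eq_top.2 h
    rwa [LinearMap.coe_range] at this
  rw [Submodule.topologicalClosure_eq_top_iff, Submodule.eq_bot_iff]
  intro φ hφ
  -- `-θ` is the trajectory with initial point `-∫₀^τ φ` and velocity `φ`
  set a : V := -∫ r in 0..τ, φ r with ha
  set w := traj a φ with hw
  have hwτ : w τ = 0 := by simp [hw, traj, ha]
  set v : TimeL2 τ V := (memLp_traj hτ a φ).toLp with hv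
  have hvw : v =ᵐ[volume.restrict (Ioo 0 τ)] w := MemLp.coeFn_toLp _
  have h0 : ⟪T v, φ⟫ = 0 := (Submodule.mem_orthogonal _ _).1 hφ _ ⟨v, rfl⟩
  have hsrc : T v =ᵐ[volume.restrict (Ioo 0 τ)] fun t => gram ι (v t) + B (traj 0 v t) :=
    coeFn_source hτ ι B (0, v)
  -- integration by parts for the two summands of the source
  obtain ⟨i1, i2, h1⟩ := bilin_primitive_sub
    ((innerSL ℝ : H →L[ℝ] H →L[ℝ] ℝ).bilinearComp ι ι) hτ (φ.integrableOn le_rfl)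
    (φ.integrableOn le_rfl) a a
  obtain ⟨j1, j2, h2⟩ := bilin_primitive_sub
    ((innerSL ℝ : V →L[ℝ] V →L[ℝ] ℝ).comp B) hτ (v.integrableOn le_rfl)
    (φ.integrableOn le_rfl) 0 a
  change IntegrableOn (fun t => ⟪ι (φ t), ι (w t)⟫) _ at i1
  change IntegrableOn (fun t => ⟪ι (w t), ι (φ t)⟫) _ at i2
  change IntegrableOn (fun t => ⟪B (v t), w t⟫) _ at j1
  change IntegrableOn (fun t => ⟪B (traj 0 v t), φ t⟫) _ at j2
  change ⟪ι (w τ), ι (w τ)⟫ - ⟪ι a, ι a⟫ = (∫ t in 0..τ, ⟪ι (φ t), ι (w t)⟫) +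
    ∫ t in 0..τ, ⟪ι (w t), ι (φ t)⟫ at h1
  change ⟪B (traj 0 v τ), w τ⟫ - ⟪B 0, a⟫ = (∫ t in 0..τ, ⟪B (v t), w t⟫) +
    ∫ t in 0..τ, ⟪B (traj 0 v t), φ t⟫ at h2
  simp only [hwτ, map_zero, inner_zero_right, inner_zero_left, zero_sub, sub_self,
    ← integral_Ioo_eq_interval hτ] at h1 h2
  have hcomm : ∀ t, ⟪ι (φ t), ι (w t)⟫ = ⟪ι (w t), ι (φ t)⟫ := fun t => real_inner_comm _ _
  simp only [hcomm] at h1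
  have e0 : ⟪T v, φ⟫ = (∫ t in Ioo 0 τ, ⟪ι (w t), ι (φ t)⟫) +
      ∫ t in Ioo 0 τ, ⟪B (traj 0 v t), φ t⟫ := by
    rw [L2.inner_def, ← integral_add (i2.mono_set Ioo_subset_Ioc_self)
      (j2.mono_set Ioo_subset_Ioc_self)]
    refine integral_congr_ae ?_
    filter_upwards [hsrc, hvw] with t h3 h4
    rw [h3, inner_add_left, inner_gram_left, h4]
  have e1 : ∫ t in Ioo 0 τ, ⟪B (v t), w t⟫ = ∫ t in Ioo 0 τ, ⟪B (w t), w t⟫ := by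
    refine integral_congr_ae ?_
    filter_upwards [hvw] with t h4
    rw [h4]
  have j3 : Integrable (fun t => ⟪B (w t), w t⟫) (volume.restrict (Ioo 0 τ)) := by
    refine (j1.mono_set Ioo_subset_Ioc_self).congr ?_
    filter_upwards [hvw] with t h4
    rw [h4]
  have hsum : ∫ t in Ioo 0 τ, ⟪B (w t), w t⟫ ≤ 0 := by
    have := real_inner_self_nonneg (x := ι a)
    rw [e1] at h2
    rw [h0] at e0
    linarith
  have hBn : ∀ x, 0 ≤ ⟪B x, x⟫ := fun x => (by positivity : 0 ≤ c * ‖x‖ ^ 2).trans (hB x)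
  have hz : (fun t => ⟪B (w t), w t⟫) =ᵐ[volume.restrict (Ioo 0 τ)] 0 :=
    (integral_eq_zero_iff_of_nonneg (fun t => hBn (w t)) j3).1
      (le_antisymm hsum (integral_nonneg fun t => hBn (w t)))
  have hw0 : w =ᵐ[volume.restrict (Ioo 0 τ)] fun _ => 0 := by
    filter_upwards [hz] with t ht
    have h5 := hB (w t)
    rw [Pi.zero_apply] at ht
    rw [ht] at h5
    have h6 : ‖w t‖ ^ 2 ≤ 0 := by
      by_contra hcon
      exact absurd h5 (not_le.2 (mul_pos hc (not_le.1 hcon)))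
    simpa using h6
  have hwc : ContinuousOn w (Icc 0 τ) := continuousOn_traj hτ a φ
  rcases hτ.eq_or_lt with rfl | hpos
  · rw [Lp.eq_zero_iff_ae_eq_zero]
    simp [Filter.EventuallyEq]
  have hwz : EqOn w (fun _ => 0) (Icc 0 τ) := by
    refine (Measure.eqOn_open_of_ae_eq hw0 isOpen_Ioo (hwc.mono Ioo_subset_Icc_self)
      continuousOn_const).of_subset_closure hwc continuousOn_const Ioo_subset_Icc_self ?_
    rw [closure_Ioo hpos.ne]
  have ha0 : a = 0 := by
    have := hwz (left_mem_Icc.2 hτ)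
    simpa [hw, traj] using this
  rw [Lp.eq_zero_iff_ae_eq_zero]
  refine ae_eq_zero_of_primitive_eq_zero hτ (φ.integrableOn le_rfl) fun t ht => ?_
  have := hwz ht
  simpa [hw, traj, ha0] using this

end Evolution

/-! ### Solutions as limits of trajectories -/

section Limits

open Filter Topology RealInnerProductSpace

variable {V H : Type*} [NormedAddCommGroup V] [InnerProductSpace ℝ V] [CompleteSpace V]
  [NormedAddCommGroup H] [InnerProductSpace ℝ H] [CompleteSpace H]

/-- `u ∈ C([0,τ]; H)` and `y ∈ L²(0,τ; V)` are the limits of a sequence of trajectories whose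
initial points converge to `u₀` in `H` and whose sources converge to `f`. Thus `u` and `y`, which
agree almost everywhere, are a solution of `u_t + B u = f`, `u(0) = u₀`. -/
structure IsLimitSolution {τ : ℝ} (hτ : 0 ≤ τ) (ι : V →L[ℝ] H) (B : V →L[ℝ] V) (u₀ : H)
    (f : TimeL2 τ V) (u : ℝ → H) (y : TimeL2 τ V) : Prop where
  continuousOn : ContinuousOn u (Icc 0 τ)
  exists_seq : ∃ z : ℕ → V × TimeL2 τ V,
    Tendsto (fun n => ι (z n).1) atTop (𝓝 u₀) ∧
    Tendsto (fun n => source hτ ι B (z n)) atTop (𝓝 f) ∧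
    (∀ t ∈ Icc 0 τ, Tendsto (fun n => ι (traj (z n).1 (z n).2 t)) atTop (𝓝 (u t))) ∧
    Tendsto (fun n => trajL2 hτ (z n)) atTop (𝓝 y)

variable {τ : ℝ} {ι : V →L[ℝ] H} {B : V →L[ℝ] V}

/-- Existence for arbitrary data: the data of trajectories are dense, and by the energy estimate
the trajectories form a Cauchy sequence once their data do. -/
theorem exists_isLimitSolution (hτ : 0 ≤ τ) (hι : DenseRange ι) {c : ℝ} (hc : 0 < c)
    (hB : ∀ x, c * ‖x‖ ^ 2 ≤ ⟪B x, x⟫) (u₀ : H) (f : TimeL2 τ V) :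
    ∃ u y, IsLimitSolution hτ ι B u₀ f u y := by
  have hδ : ∀ n : ℕ, (0 : ℝ) < 1 / (n + 1) := fun n => Nat.one_div_pos_of_nat
  choose a ha using fun n : ℕ => hι.exists_dist_lt u₀ (hδ n)
  choose v hv using fun n : ℕ => (dense_range_source hτ ι B hc hB).exists_dist_lt
    (f - source hτ ι B (a n, 0)) (hδ n)
  set z : ℕ → V × TimeL2 τ V := fun n => (a n, v n) with hz
  have hsrc : ∀ n, source hτ ι B (z n) = source hτ ι B (a n, 0) + source hτ ι B (0, v n) := by
    intro n
    rw [← map_add]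
    simp [hz]
  have h1 : Tendsto (fun n => ι (z n).1) atTop (𝓝 u₀) := by
    rw [tendsto_iff_dist_tendsto_zero]
    refine squeeze_zero (fun _ => dist_nonneg) (fun n => ?_) tendsto_one_div_add_atTop_nhds_zero_nat
    rw [dist_comm]
    exact (ha n).le
  have h2 : Tendsto (fun n => source hτ ι B (z n)) atTop (𝓝 f) := by
    rw [tendsto_iff_dist_tendsto_zero]
    refine squeeze_zero (fun _ => dist_nonneg) (fun n => ?_) tendsto_one_div_add_atTop_nhds_zero_nat
    have := (hv n).le
    rw [dist_comm, dist_eq_norm, hsrc, ← sub_sub, ← dist_eq_norm]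
    exact this
  -- the size of the difference of the data
  let M : ℕ × ℕ → ℝ := fun p =>
    ‖ι (z p.1).1 - ι (z p.2).1‖ ^ 2 + c⁻¹ * ‖source hτ ι B (z p.1) - source hτ ι B (z p.2)‖ ^ 2
  have hM : Tendsto M atTop (𝓝 0) := by
    have e1 := cauchySeq_iff_tendsto_dist_atTop_0.1 h1.cauchySeq
    have e2 := cauchySeq_iff_tendsto_dist_atTop_0.1 h2.cauchySeq
    have := (e1.pow 2).add ((e2.pow 2).const_mul c⁻¹)
    simpa [M, dist_eq_norm] using this
  have hMt : ∀ p t, t ∈ Icc 0 τ → ‖ι (traj (z p.1).1 (z p.1).2 t) -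
      ι (traj (z p.2).1 (z p.2).2 t)‖ ^ 2 ≤ M p := by
    intro p t ht
    have e := norm_sq_apply_traj_le hτ ι B hc hB (z p.1 - z p.2) ht
    have e' : traj (z p.1 - z p.2).1 (z p.1 - z p.2).2 t =
        traj (z p.1).1 (z p.1).2 t - traj (z p.2).1 (z p.2).2 t := by
      have e1 := traj_add (z p.1 - z p.2).1 (z p.2).1 (z p.1 - z p.2).2 (z p.2).2 ht
      rw [← Prod.fst_add, ← Prod.snd_add, sub_add_cancel] at e1
      rw [e1, add_sub_cancel_right]
    rw [e', map_sub, map_sub, Prod.fst_sub, map_sub] at e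
    exact e
  have hMy : ∀ p, c * ‖trajL2 hτ (z p.1) - trajL2 hτ (z p.2)‖ ^ 2 ≤ M p := by
    intro p
    have e := norm_sq_trajL2_le hτ ι B hc hB (z p.1 - z p.2)
    rw [map_sub, map_sub, Prod.fst_sub, map_sub] at e
    exact e
  have hy : CauchySeq fun n => trajL2 hτ (z n) := by
    rw [cauchySeq_iff_tendsto_dist_atTop_0]
    have e : Tendsto (fun p => Real.sqrt (c⁻¹ * M p)) atTop (𝓝 0) := by
      have := (hM.const_mul c⁻¹).sqrt
      simpa using this
    refine squeeze_zero (fun _ => dist_nonneg) (fun p => ?_) e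
    refine Real.le_sqrt_of_sq_le ?_
    rw [dist_eq_norm, le_inv_mul_iff₀ hc]
    exact hMy p
  obtain ⟨y, hy⟩ := cauchySeq_tendsto_of_complete hy
  have hU : UniformCauchySeqOn (fun n t => ι (traj (z n).1 (z n).2 t)) atTop (Icc 0 τ) := by
    rw [Metric.uniformCauchySeqOn_iff]
    intro δ hδ
    have e := hM.eventually (gt_mem_nhds (by positivity : (0 : ℝ) < δ ^ 2))
    obtain ⟨N, hN⟩ := eventually_atTop_prod_self.1 e
    refine ⟨N, fun m hm n hn t ht => ?_⟩
    rw [dist_eq_norm]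
    refine lt_of_pow_lt_pow_left₀ 2 hδ.le ?_
    exact (hMt (m, n) t ht).trans_lt (hN m n hm hn)
  have hpt : ∀ t ∈ Icc 0 τ, ∃ x, Tendsto (fun n => ι (traj (z n).1 (z n).2 t)) atTop (𝓝 x) :=
    fun t ht => cauchySeq_tendsto_of_complete (hU.cauchySeq ht)
  choose! u hu using hpt
  refine ⟨u, y, ?_, z, h1, h2, hu, hy⟩
  refine (hU.tendstoUniformlyOn_of_tendsto hu).continuousOn (Eventually.frequently ?_)
  exact .of_forall fun n => ι.continuous.comp_continuousOn (continuousOn_traj hτ _ _)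

namespace IsLimitSolution

variable {hτ : 0 ≤ τ} {u₀ : H} {f : TimeL2 τ V} {u : ℝ → H} {y : TimeL2 τ V}

theorem initial (hu : IsLimitSolution hτ ι B u₀ f u y) : u 0 = u₀ := by
  obtain ⟨z, h1, -, h3, -⟩ := hu.exists_seq
  refine tendsto_nhds_unique (h3 0 (left_mem_Icc.2 hτ)) ?_
  simpa [traj] using h1

theorem ae_eq (hu : IsLimitSolution hτ ι B u₀ f u y) :
    ∀ᵐ t ∂volume.restrict (Ioo 0 τ), u t = ι (y t) := by
  obtain ⟨z, -, -, h3, h4⟩ := hu.exists_seq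
  obtain ⟨ns, hns, hae⟩ := (tendstoInMeasure_of_tendsto_Lp h4).exists_seq_tendsto_ae
  have hall : ∀ᵐ t ∂volume.restrict (Ioo 0 τ), ∀ n, trajL2 hτ (z n) t = traj (z n).1 (z n).2 t :=
    ae_all_iff.2 fun n => coeFn_trajL2 hτ (z n)
  filter_upwards [hae, hall, ae_restrict_mem measurableSet_Ioo] with t ht1 ht2 ht3
  have e1 := (h3 t (Ioo_subset_Icc_self ht3)).comp hns.tendsto_atTop
  simp only [ht2] at ht1
  exact tendsto_nhds_unique e1 ((ι.continuous.tendsto _).comp ht1)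

/-- The weak form, in the Riesz representation, of `u_t = f - B u`. -/
theorem weak_deriv (hu : IsLimitSolution hτ ι B u₀ f u y) {η : ℝ → ℝ}
    (hη : ContDiff ℝ (⊤ : ℕ∞) η) (hηs : tsupport η ⊆ Ioo 0 τ) :
    ∫ t in Ioo 0 τ, deriv η t • gram ι (y t) = -∫ t in Ioo 0 τ, η t • (f t - B (y t)) := by
  obtain ⟨z, -, h2, -, h4⟩ := hu.exists_seq
  have hηL : MemLp η 2 (volume.restrict (Ioo 0 τ)) :=
    memLp_of_continuousOn hη.continuous.continuousOn
  have hdL : MemLp (deriv η) 2 (volume.restrict (Ioo 0 τ)) :=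
    memLp_of_continuousOn (hη.continuous_deriv (by simp)).continuousOn
  let Λ : TimeL2 τ ℝ →L[ℝ] TimeL2 τ V →L[ℝ] V :=
    (ContinuousLinearMap.lsmul ℝ ℝ (E := V)).lpPairing (volume.restrict (Ioo 0 τ)) 2 2
  have hΛ : ∀ {g : ℝ → ℝ} (hg : MemLp g 2 (volume.restrict (Ioo 0 τ))) (x : TimeL2 τ V),
      Λ hg.toLp x = ∫ t in Ioo 0 τ, g t • x t := by
    intro g hg x
    rw [ContinuousLinearMap.lpPairing_eq_integral]
    refine integral_congr_ae ?_
    filter_upwards [hg.coeFn_toLp] with t ht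
    rw [ht]
    rfl
  have hi : ∀ {g : ℝ → ℝ}, MemLp g 2 (volume.restrict (Ioo 0 τ)) → ∀ x : TimeL2 τ V,
      Integrable (fun t => g t • x t) (volume.restrict (Ioo 0 τ)) := fun hg x =>
    memLp_one_iff_integrable.1 ((Lp.memLp x).smul (r := 1) hg)
  have hE : ∀ {g : ℝ → ℝ} (hg : MemLp g 2 (volume.restrict (Ioo 0 τ))) (x : TimeL2 τ V),
      gram ι (∫ t in Ioo 0 τ, g t • x t) = ∫ t in Ioo 0 τ, g t • gram ι (x t) := by
    intro g hg x
    rw [← ContinuousLinearMap.integral_comp_comm _ (hi hg x)]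
    simp only [map_smul]
  have hn : ∀ n, gram ι (Λ hdL.toLp (trajL2 hτ (z n))) =
      -Λ hηL.toLp (source hτ ι B (z n) - B.compLpL 2 _ (trajL2 hτ (z n))) := by
    intro n
    have e1 := weak_deriv_primitive hτ ((z n).2.integrableOn le_rfl) (z n).1 hη hηs
    have e2 : Λ hdL.toLp (trajL2 hτ (z n)) = -∫ t in Ioo 0 τ, η t • (z n).2 t := by
      rw [← e1, hΛ]
      refine integral_congr_ae ?_
      filter_upwards [coeFn_trajL2 hτ (z n)] with t ht
      rw [ht]
      rfl
    rw [e2, map_neg, hE hηL, hΛ]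
    congr 1
    refine integral_congr_ae ?_
    filter_upwards [coeFn_source hτ ι B (z n), coeFn_trajL2 hτ (z n),
      B.coeFn_compLpL (trajL2 hτ (z n)),
      Lp.coeFn_sub (source hτ ι B (z n)) (B.compLpL 2 _ (trajL2 hτ (z n)))] with t e2 e3 e4 e5
    rw [e5, Pi.sub_apply, e4, e3, e2, add_sub_cancel_right]
  have hL : Tendsto (fun n => gram ι (Λ hdL.toLp (trajL2 hτ (z n)))) atTop
      (𝓝 (gram ι (Λ hdL.toLp y))) :=
    (((gram ι).comp (Λ hdL.toLp)).continuous.tendsto y).comp h4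
  have hR : Tendsto (fun n => -Λ hηL.toLp (source hτ ι B (z n) -
      B.compLpL 2 _ (trajL2 hτ (z n)))) atTop (𝓝 (-Λ hηL.toLp (f - B.compLpL 2 _ y))) :=
    (((Λ hηL.toLp).continuous.tendsto _).comp
      (h2.sub (((B.compLpL 2 _).continuous.tendsto _).comp h4))).neg
  simp only [hn] at hL
  have := tendsto_nhds_unique hL hR
  rw [hΛ, hE hdL, hΛ] at this
  rw [this]
  congr 1
  refine integral_congr_ae ?_
  filter_upwards [Lp.coeFn_sub f (B.compLpL 2 _ y), B.coeFn_compLpL y] with t e1 e2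
  rw [e1, Pi.sub_apply, e2]

/-- Green's formula for a limit solution `u` and a function `r ∈ C([0,τ]; H)` that equals
`q ∈ L²(0,τ; V)` almost everywhere and has the time derivative `g ∈ L²(0,τ; V')`. -/
theorem green (hu : IsLimitSolution hτ ι B u₀ f u y) {r : ℝ → H} {q g : TimeL2 τ V}
    (hrq : ∀ᵐ t ∂volume.restrict (Ioo 0 τ), r t = ι (q t))
    (hr : ∀ t ∈ Icc 0 τ, ι.adjoint (r t) = ι.adjoint (r 0) + ∫ s in 0..t, g s) :
    ⟪u τ, r τ⟫ - ⟪u₀, r 0⟫ = ⟪f - B.compLpL 2 _ y, q⟫ + ⟪y, g⟫ := by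
  obtain ⟨z, h1, h2, h3, h4⟩ := hu.exists_seq
  have hn : ∀ n, ⟪ι (traj (z n).1 (z n).2 τ), r τ⟫ - ⟪ι (z n).1, r 0⟫ =
      ⟪source hτ ι B (z n) - B.compLpL 2 _ (trajL2 hτ (z n)), q⟫ + ⟪trajL2 hτ (z n), g⟫ := by
    intro n
    obtain ⟨i1, i2, e⟩ := bilin_primitive_sub (innerSL ℝ : V →L[ℝ] V →L[ℝ] ℝ) hτ
      ((z n).2.integrableOn le_rfl) (g.integrableOn le_rfl) (z n).1 (ι.adjoint (r 0))
    rw [← hr τ (right_mem_Icc.2 hτ),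
      ← integral_Ioo_eq_interval hτ (fun t => innerSL ℝ ((z n).2 t) _),
      ← integral_Ioo_eq_interval hτ (fun t => innerSL ℝ (_ + _) (g t))] at e
    rw [← ContinuousLinearMap.adjoint_inner_right, ← ContinuousLinearMap.adjoint_inner_right]
    refine Eq.trans e ?_
    rw [L2.inner_def, L2.inner_def]
    congr 1
    · refine integral_congr_ae ?_
      filter_upwards [hrq, coeFn_source hτ ι B (z n), coeFn_trajL2 hτ (z n),
        B.coeFn_compLpL (trajL2 hτ (z n)),
        Lp.coeFn_sub (source hτ ι B (z n)) (B.compLpL 2 _ (trajL2 hτ (z n))),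
        ae_restrict_mem measurableSet_Ioo] with t e1 e2 e3 e4 e5 ht
      rw [e5, Pi.sub_apply, e4, e3, e2, add_sub_cancel_right, inner_gram_left,
        ← hr t (Ioo_subset_Icc_self ht), e1]
      exact ContinuousLinearMap.adjoint_inner_right _ _ _
    · refine integral_congr_ae ?_
      filter_upwards [coeFn_trajL2 hτ (z n)] with t e1
      rw [e1]
      rfl
  have hL : Tendsto (fun n => ⟪ι (traj (z n).1 (z n).2 τ), r τ⟫ - ⟪ι (z n).1, r 0⟫) atTop
      (𝓝 (⟪u τ, r τ⟫ - ⟪u₀, r 0⟫)) :=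
    ((h3 τ (right_mem_Icc.2 hτ)).inner tendsto_const_nhds).sub (h1.inner tendsto_const_nhds)
  have hR : Tendsto (fun n => ⟪source hτ ι B (z n) - B.compLpL 2 _ (trajL2 hτ (z n)), q⟫ +
      ⟪trajL2 hτ (z n), g⟫) atTop (𝓝 (⟪f - B.compLpL 2 _ y, q⟫ + ⟪y, g⟫)) :=
    ((h2.sub (((B.compLpL 2 _).continuous.tendsto _).comp h4)).inner tendsto_const_nhds).add
      (h4.inner tendsto_const_nhds)
  simp only [hn] at hL
  exact tendsto_nhds_unique hL hR

end IsLimitSolution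

end Limits

/-! ### The space `H_0^s(Ω)` -/

section Space

open Filter Topology RealInnerProductSpace

/-- The difference quotient of an element of `H_0^s(Ω)`, as an element of `L²(ℝ²)`. -/
def HZero.quot (s : ℝ) : HZero s →L[ℝ] Lp ℝ 2 (volume : Measure (ℝ × ℝ)) :=
  (WithLp.sndL 2 ℝ (Lp ℝ 2 (volume : Measure ℝ)) (Lp ℝ 2 (volume : Measure (ℝ × ℝ)))).comp
    (HZero.incl s)

variable {s : ℝ}

theorem HZero.coeFn_quot (u : HZero s) : HZero.quot s u =ᵐ[volume] diffQuot s u.toL2 := u.2.1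

theorem HZero.toL2_eq_zero (u : HZero s) : ∀ᵐ x : ℝ, x ∉ Omega → u.toL2 x = 0 := u.2.2

theorem HZero.norm_sq (u : HZero s) : ‖u‖ ^ 2 = ‖u.toL2‖ ^ 2 + ‖HZero.quot s u‖ ^ 2 :=
  WithLp.prod_norm_sq_eq_of_L2 (HZero.incl s u)

theorem coeFn_restrictTo (E : Set ℝ) (u : HZero s) :
    restrictTo s E u =ᵐ[volume.restrict E] u.toL2 :=
  LpToLpRestrictCLM_coeFn ℝ E u.toL2

theorem isClosed_hZero (s : ℝ) : IsClosed (hZero s : Set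
    (WithLp 2 (Lp ℝ 2 (volume : Measure ℝ) × Lp ℝ 2 (volume : Measure (ℝ × ℝ))))) := by
  refine IsSeqClosed.isClosed fun x z hx hxz => ?_
  have h1 : Tendsto (fun n => (x n).fst) atTop (𝓝 z.fst) :=
    ((WithLp.fstL 2 ℝ (Lp ℝ 2 (volume : Measure ℝ))
      (Lp ℝ 2 (volume : Measure (ℝ × ℝ)))).continuous.tendsto z).comp hxz
  have h2 : Tendsto (fun n => (x n).snd) atTop (𝓝 z.snd) :=
    ((WithLp.sndL 2 ℝ (Lp ℝ 2 (volume : Measure ℝ))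
      (Lp ℝ 2 (volume : Measure (ℝ × ℝ)))).continuous.tendsto z).comp hxz
  obtain ⟨ns, hns, hae⟩ := (tendstoInMeasure_of_tendsto_Lp h1).exists_seq_tendsto_ae
  obtain ⟨ms, hms, hae'⟩ := (tendstoInMeasure_of_tendsto_Lp
    (h2.comp hns.tendsto_atTop)).exists_seq_tendsto_ae
  refine ⟨?_, ?_⟩
  · have hq : ∀ᵐ q : ℝ × ℝ, ∀ n, (x n).snd q = diffQuot s (x n).fst q :=
      ae_all_iff.2 fun n => (hx n).1
    have e1 : ∀ᵐ q : ℝ × ℝ, Tendsto (fun n => (x (ns n)).fst q.1) atTop (𝓝 (z.fst q.1)) :=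
      Measure.quasiMeasurePreserving_fst.ae hae
    have e2 : ∀ᵐ q : ℝ × ℝ, Tendsto (fun n => (x (ns n)).fst q.2) atTop (𝓝 (z.fst q.2)) :=
      Measure.quasiMeasurePreserving_snd.ae hae
    filter_upwards [hq, e1, e2, hae'] with q h3 h4 h5 h6
    have h7 := ((h4.sub h5).div_const (|q.1 - q.2| ^ ((1 + 2 * s) / 2))).comp hms.tendsto_atTop
    refine tendsto_nhds_unique h6 (h7.congr fun n => ?_)
    simp only [Function.comp_apply, h3, diffQuot]
  · have hq : ∀ᵐ t : ℝ, ∀ n, t ∉ Omega → (x n).fst t = 0 := ae_all_iff.2 fun n => (hx n).2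
    filter_upwards [hq, hae] with t h3 h4 ht
    refine tendsto_nhds_unique h4 ?_
    simp only [h3 _ ht]
    exact tendsto_const_nhds

instance (s : ℝ) : CompleteSpace (HZero s) := (isClosed_hZero s).completeSpace_coe

theorem sq_rpow_half {r : ℝ} (hr : 0 ≤ r) (a : ℝ) : (r ^ (a / 2)) ^ 2 = r ^ a := by
  rw [← Real.rpow_natCast, ← Real.rpow_mul hr]
  norm_num

theorem diffQuot_sq (s : ℝ) (u : ℝ → ℝ) (q : ℝ × ℝ) :
    diffQuot s u q ^ 2 = (u q.1 - u q.2) ^ 2 / |q.1 - q.2| ^ (1 + 2 * s) := by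
  rw [diffQuot, div_pow, sq_rpow_half (abs_nonneg _)]

theorem fracForm_eq_inner (u v : HZero s) :
    fracForm s u v = fracConst s / 2 * ⟪HZero.quot s u, HZero.quot s v⟫ := by
  rw [fracForm, L2.inner_def]
  congr 1
  refine integral_congr_ae ?_
  filter_upwards [u.coeFn_quot, v.coeFn_quot] with q h1 h2
  rw [h1, h2, ← sq_rpow_half (abs_nonneg _), diffQuot, diffQuot]
  simp only [RCLike.inner_apply, conj_trivial]
  rw [div_mul_div_comm, sq, mul_comm (v.toL2 q.1 - v.toL2 q.2)]

theorem fracConst_pos (hs₀ : 0 < s) (hs₁ : s < 1) : 0 < fracConst s := by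
  have h1 : 0 < Real.Gamma ((2 * s + 1) / 2) := Real.Gamma_pos_of_pos (by positivity)
  have h2 : 0 < Real.Gamma (1 - s) := Real.Gamma_pos_of_pos (by linarith)
  have := Real.pi_pos
  unfold fracConst
  positivity

/-- The fractional Poincaré inequality. An element `u` of `H_0^s(Ω)` vanishes on `(2,3)`, and the
part of the double integral over `Ω × (2,3)` already dominates `‖u‖²`. -/
theorem HZero.poincare (hs₀ : 0 < s) (u : HZero s) :
    ((4 : ℝ) ^ (1 + 2 * s))⁻¹ * ‖u.toL2‖ ^ 2 ≤ ‖HZero.quot s u‖ ^ 2 := by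
  have hq : ‖HZero.quot s u‖ ^ 2 = ∫ q : ℝ × ℝ, ‖HZero.quot s u q‖ ^ 2 := by
    rw [← real_inner_self_eq_norm_sq, L2.inner_def]
    simp only [real_inner_self_eq_norm_sq]
  have hu : ‖u.toL2‖ ^ 2 = ∫ x : ℝ, ‖u.toL2 x‖ ^ 2 := by
    rw [← real_inner_self_eq_norm_sq, L2.inner_def]
    simp only [real_inner_self_eq_norm_sq]
  have hui : Integrable (fun x : ℝ => ‖u.toL2 x‖ ^ 2) :=
    (memLp_two_iff_integrable_sq_norm (Lp.memLp u.toL2).1).1 (Lp.memLp u.toL2)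
  have hqi : Integrable (fun q : ℝ × ℝ => ‖HZero.quot s u q‖ ^ 2) :=
    (memLp_two_iff_integrable_sq_norm (Lp.memLp (HZero.quot s u)).1).1 (Lp.memLp _)
  have huΩ : ∫ x : ℝ, ‖u.toL2 x‖ ^ 2 = ∫ x in Omega, ‖u.toL2 x‖ ^ 2 := by
    rw [← integral_indicator measurableSet_Ioo]
    refine integral_congr_ae ?_
    filter_upwards [u.toL2_eq_zero] with x hx
    by_cases h : x ∈ Omega
    · rw [indicator_of_mem h]
    · rw [indicator_of_notMem h, hx h]; simp
  have hprod : ∫ q in Omega ×ˢ Ioo (2 : ℝ) 3, ‖u.toL2 q.1‖ ^ 2 * (1 : ℝ) =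
      ∫ x in Omega, ‖u.toL2 x‖ ^ 2 := by
    have := setIntegral_prod_mul (μ := (volume : Measure ℝ)) (ν := (volume : Measure ℝ))
      (fun x : ℝ => ‖u.toL2 x‖ ^ 2) (fun _ : ℝ => (1 : ℝ)) Omega (Ioo 2 3)
    rw [Measure.volume_eq_prod, this]
    simp
    norm_num
  have hpi : IntegrableOn (fun q : ℝ × ℝ => ‖u.toL2 q.1‖ ^ 2 * (1 : ℝ))
      (Omega ×ˢ Ioo (2 : ℝ) 3) := by
    rw [IntegrableOn, Measure.volume_eq_prod, ← Measure.prod_restrict]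
    exact hui.integrableOn.mul_prod (integrable_const (1 : ℝ))
  have hz : ∀ᵐ q : ℝ × ℝ, q.2 ∉ Omega → u.toL2 q.2 = 0 :=
    Measure.quasiMeasurePreserving_snd.ae u.toL2_eq_zero
  rw [hu, huΩ, ← hprod, ← integral_const_mul, hq]
  refine le_trans ?_ (setIntegral_le_integral (s := Omega ×ˢ Ioo (2 : ℝ) 3) hqi
    (.of_forall fun _ => by positivity))
  refine integral_mono_ae (hpi.const_mul _) hqi.integrableOn ?_
  filter_upwards [ae_restrict_of_ae hz, ae_restrict_of_ae u.coeFn_quot,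
    ae_restrict_mem (measurableSet_Ioo.prod measurableSet_Ioo)] with q h1 h2 h3
  have h4 : u.toL2 q.2 = 0 := h1 fun h => by linarith [h.2, h3.2.1]
  rw [h2, Real.norm_eq_abs (diffQuot _ _ _), sq_abs, diffQuot_sq, h4, sub_zero, mul_one,
    Real.norm_eq_abs, sq_abs, inv_mul_eq_div]
  have h5 : 0 < |q.1 - q.2| := abs_pos.2 (by linarith [h3.1.2, h3.2.1])
  have h6 : |q.1 - q.2| ≤ 4 := by
    rw [abs_le]; constructor <;> linarith [h3.1.1, h3.1.2, h3.2.1, h3.2.2]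
  gcongr

/-- The operator on `H_0^s(Ω)` that represents the form `fracForm`. -/
def fracOp (s : ℝ) : HZero s →L[ℝ] HZero s := (fracConst s / 2) • gram (HZero.quot s)

theorem inner_fracOp (u v : HZero s) : ⟪fracOp s u, v⟫ = fracForm s u v := by
  rw [fracForm_eq_inner, fracOp, smul_apply, real_inner_smul_left, inner_gram_left]

theorem fracForm_comm (u v : HZero s) : fracForm s u v = fracForm s v u := by
  rw [fracForm_eq_inner, fracForm_eq_inner, real_inner_comm]

theorem exists_coercive (hs₀ : 0 < s) (hs₁ : s < 1) :
    ∃ c, 0 < c ∧ ∀ u : HZero s, c * ‖u‖ ^ 2 ≤ ⟪fracOp s u, u⟫ := by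
  have hC := fracConst_pos hs₀ hs₁
  set K : ℝ := (4 : ℝ) ^ (1 + 2 * s) with hK
  have hKpos : 0 < K := by positivity
  refine ⟨fracConst s / 2 * (K + 1)⁻¹, by positivity, fun u => ?_⟩
  rw [inner_fracOp, fracForm_eq_inner, real_inner_self_eq_norm_sq, u.norm_sq, mul_assoc]
  refine mul_le_mul_of_nonneg_left ?_ (by positivity)
  have h := HZero.poincare hs₀ u
  rw [← hK, inv_mul_le_iff₀ hKpos] at h
  rw [inv_mul_le_iff₀ (by positivity)]
  linarith

/-! ### Test functions belong to `H_0^s(Ω)` -/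

/-- The integrable kernel `|r|^{1-2s}` for `|r| ≤ 1`, `|r|^{-1-2s}` for `|r| > 1`, which controls
the Gagliardo integrand of a bounded Lipschitz function. -/
def gagliardoKernel (s r : ℝ) : ℝ :=
  if |r| ≤ 1 then |r| ^ (1 - 2 * s) else |r| ^ (-1 - 2 * s)

theorem gagliardoKernel_nonneg (s r : ℝ) : 0 ≤ gagliardoKernel s r := by
  unfold gagliardoKernel
  split_ifs <;> positivity

theorem integrable_gagliardoKernel (hs₀ : 0 < s) (hs₁ : s < 1) :
    Integrable (gagliardoKernel s) := by
  have h1 : IntegrableOn (gagliardoKernel s) (Ioc 0 1) := by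
    have := (intervalIntegral.intervalIntegrable_rpow' (a := 0) (b := 1)
      (by linarith : -1 < 1 - 2 * s)).1
    refine this.congr_fun (fun r hr => ?_) measurableSet_Ioc
    simp only [gagliardoKernel]
    rw [abs_of_pos hr.1, if_pos hr.2]
  have h2 : IntegrableOn (gagliardoKernel s) (Ioi 1) := by
    have := integrableOn_Ioi_rpow_of_lt (by linarith : -1 - 2 * s < -1) one_pos
    refine this.congr_fun (fun r hr => ?_) measurableSet_Ioi
    have hr' : 1 < r := hr
    simp only [gagliardoKernel]
    rw [abs_of_pos (by linarith), if_neg (not_le.2 hr')]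
  have h3 : IntegrableOn (gagliardoKernel s) (Ioi 0) := by
    rw [← Ioc_union_Ioi_eq_Ioi zero_le_one]
    exact h1.union h2
  have h4 : IntegrableOn (gagliardoKernel s) (Iic 0) := by
    rw [← Measure.map_neg_eq_self (volume : Measure ℝ)]
    let m : MeasurableEmbedding fun x : ℝ => -x := (Homeomorph.neg ℝ).measurableEmbedding
    rw [m.integrableOn_map_iff]
    have e : gagliardoKernel s ∘ (fun x : ℝ => -x) = gagliardoKernel s := by
      ext x; simp [gagliardoKernel]
    rw [e, neg_preimage, neg_Iic, neg_zero]
    exact Iff.mpr integrableOn_Ici_iff_integrableOn_Ioi h3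
  rw [← integrableOn_univ, ← Iic_union_Ioi (a := (0 : ℝ))]
  exact h4.union h3

theorem memLp_diffQuot (hs₀ : 0 < s) (hs₁ : s < 1) {g : ℝ → ℝ} (hg : ContDiff ℝ (⊤ : ℕ∞) g)
    (hgc : HasCompactSupport g) (hgs : tsupport g ⊆ Omega) :
    MemLp (diffQuot s g) 2 (volume : Measure (ℝ × ℝ)) := by
  obtain ⟨L, hL⟩ := hg.lipschitzWith_of_hasCompactSupport hgc (by simp)
  obtain ⟨M, hM⟩ := hgc.exists_bound_of_continuous hg.continuous
  have hmeas : Measurable (diffQuot s g) := by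
    unfold diffQuot
    have := hg.continuous.measurable
    fun_prop
  rw [memLp_two_iff_integrable_sq hmeas.aestronglyMeasurable]
  set χ : ℝ → ℝ := indicator Omega (fun _ => 1) with hχ
  have hχi : Integrable χ := (integrable_indicator_iff measurableSet_Ioo).2 (by simp)
  have hχ0 : ∀ x, 0 ≤ χ x := fun x => indicator_nonneg (fun _ _ => zero_le_one) x
  have i1 : Integrable (fun q : ℝ × ℝ => χ q.2 * gagliardoKernel s (q.1 - q.2)) :=
    hχi.convolution_integrand (ContinuousLinearMap.mul ℝ ℝ) (integrable_gagliardoKernel hs₀ hs₁)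
  have i2 : Integrable (fun q : ℝ × ℝ => χ q.1 * gagliardoKernel s (q.2 - q.1)) := i1.swap
  set C : ℝ := (L : ℝ) ^ 2 + (2 * M) ^ 2 with hC
  refine ((i1.add i2).const_mul C).mono' (hmeas.pow_const 2).aestronglyMeasurable
    (.of_forall fun q => ?_)
  rw [Real.norm_eq_abs, abs_of_nonneg (sq_nonneg _), diffQuot_sq]
  have hsymm : gagliardoKernel s (q.2 - q.1) = gagliardoKernel s (q.1 - q.2) := by
    simp only [gagliardoKernel, abs_sub_comm]
  simp only [Pi.add_apply]
  rw [hsymm, ← add_mul]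
  have hk := gagliardoKernel_nonneg s (q.1 - q.2)
  by_cases hout : q.1 ∉ Omega ∧ q.2 ∉ Omega
  · have e1 : g q.1 = 0 := image_eq_zero_of_notMem_tsupport fun h => hout.1 (hgs h)
    have e2 : g q.2 = 0 := image_eq_zero_of_notMem_tsupport fun h => hout.2 (hgs h)
    rw [e1, e2]
    have := hχ0 q.1
    have := hχ0 q.2
    simp only [sub_self, ne_eq, OfNat.ofNat_ne_zero, not_false_eq_true, zero_pow, zero_div]
    positivity
  · have hχ1 : 1 ≤ χ q.2 + χ q.1 := by
      rw [not_and_or, not_not, not_not] at hout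
      rcases hout with h | h
      · have : χ q.1 = 1 := indicator_of_mem h _
        linarith [hχ0 q.2]
      · have : χ q.2 = 1 := indicator_of_mem h _
        linarith [hχ0 q.1]
    have hmain : (g q.1 - g q.2) ^ 2 / |q.1 - q.2| ^ (1 + 2 * s) ≤
        C * gagliardoKernel s (q.1 - q.2) := by
      rcases eq_or_ne q.1 q.2 with h | h
      · rw [h, sub_self]
        have := gagliardoKernel_nonneg s (q.2 - q.2)
        simp only [ne_eq, OfNat.ofNat_ne_zero, not_false_eq_true, zero_pow, zero_div]
        positivity
      have hr : 0 < |q.1 - q.2| := abs_pos.2 (sub_ne_zero.2 h)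
      have hLip : (g q.1 - g q.2) ^ 2 ≤ (L : ℝ) ^ 2 * |q.1 - q.2| ^ 2 := by
        have := hL.dist_le_mul q.1 q.2
        rw [Real.dist_eq, Real.dist_eq] at this
        rw [← sq_abs (g q.1 - g q.2), ← mul_pow]
        gcongr
      have hBdd : (g q.1 - g q.2) ^ 2 ≤ (2 * M) ^ 2 := by
        have h1 := hM q.1
        have h2 := hM q.2
        rw [← sq_abs (g q.1 - g q.2)]
        have : |g q.1 - g q.2| ≤ 2 * M := by
          refine (abs_sub _ _).trans ?_
          rw [Real.norm_eq_abs] at h1 h2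
          linarith
        gcongr
      unfold gagliardoKernel
      split_ifs with hle
      · have e : |q.1 - q.2| ^ (1 - 2 * s) = |q.1 - q.2| ^ 2 / |q.1 - q.2| ^ (1 + 2 * s) := by
          rw [← Real.rpow_natCast, ← Real.rpow_sub hr]
          congr 1
          push_cast
          ring
        rw [e, ← mul_div_assoc]
        gcongr
        refine hLip.trans ?_
        gcongr
        rw [hC]
        linarith [sq_nonneg (2 * M)]
      · have e : |q.1 - q.2| ^ (-1 - 2 * s) = 1 / |q.1 - q.2| ^ (1 + 2 * s) := by
          rw [one_div, ← Real.rpow_neg hr.le]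
          congr 1
          ring
        rw [e, ← mul_div_assoc, mul_one]
        gcongr
        refine hBdd.trans ?_
        rw [hC]
        linarith [sq_nonneg (L : ℝ)]
    refine hmain.trans ?_
    have hCk : 0 ≤ C * gagliardoKernel s (q.1 - q.2) := by positivity
    nlinarith

theorem exists_hZero_of_contDiff (hs₀ : 0 < s) (hs₁ : s < 1) {g : ℝ → ℝ}
    (hg : ContDiff ℝ (⊤ : ℕ∞) g) (hgc : HasCompactSupport g) (hgs : tsupport g ⊆ Omega) :
    ∃ u : HZero s, u.toL2 =ᵐ[volume] g := by
  have h1 : MemLp g 2 (volume : Measure ℝ) := hg.continuous.memLp_of_hasCompactSupport hgc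
  have h2 := memLp_diffQuot hs₀ hs₁ hg hgc hgs
  let z : hZero s := ⟨WithLp.toLp 2 (h1.toLp, h2.toLp), by
    refine ⟨?_, ?_⟩
    · exact h2.coeFn_toLp.trans (diffQuot_congr s h1.coeFn_toLp.symm)
    · filter_upwards [h1.coeFn_toLp] with x hx hxΩ
      exact hx.trans (image_eq_zero_of_notMem_tsupport fun h => hxΩ (hgs h))⟩
  exact ⟨z, h1.coeFn_toLp⟩

/-- `H_0^s(Ω)` is dense in `L²(Ω)`. -/
theorem denseRange_restrictTo (hs₀ : 0 < s) (hs₁ : s < 1) : DenseRange (restrictTo s Omega) := by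
  suffices h : (LinearMap.range (restrictTo s Omega).toLinearMap).topologicalClosure = ⊤ by
    have : Dense (LinearMap.range (restrictTo s Omega).toLinearMap : Set (L2 Omega)) :=
      Submodule.dense_iff_topologicalClosure_eq_top.2 h
    rwa [LinearMap.coe_range] at this
  rw [Submodule.topologicalClosure_eq_top_iff, Submodule.eq_bot_iff]
  intro f hf
  have hfi : IntegrableOn f Omega := (Lp.memLp f).integrable one_le_two
  rw [Lp.eq_zero_iff_ae_eq_zero, EventuallyEq, ae_restrict_iff' measurableSet_Ioo]
  refine isOpen_Ioo.ae_eq_zero_of_integral_contDiff_smul_eq_zero hfi.locallyIntegrableOn ?_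
  intro g hg hgc hgs
  obtain ⟨u, hu⟩ := exists_hZero_of_contDiff hs₀ hs₁ hg hgc hgs
  have h0 : ⟪restrictTo s Omega u, f⟫ = 0 := (Submodule.mem_orthogonal _ _).1 hf _ ⟨u, rfl⟩
  rw [L2.inner_def] at h0
  rw [← setIntegral_eq_integral_of_forall_compl_eq_zero (s := Omega), ← h0]
  · refine integral_congr_ae ?_
    filter_upwards [coeFn_restrictTo Omega u, ae_restrict_of_ae hu] with x h1 h2
    rw [h1, h2]
    simp [mul_comm]
  · intro x hx
    rw [image_eq_zero_of_notMem_tsupport fun h => hx (hgs h), zero_smul]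

end Space

/-! ### Existence and Green's formula for the fractional heat equation -/

section Solutions

open Filter Topology RealInnerProductSpace

variable {s τ : ℝ}

/-- The Riesz isomorphism between `H_0^s(Ω)` and `H^{-s}(Ω)`. -/
def riesz (s : ℝ) : HZero s ≃ₗᵢ[ℝ] HNeg s := InnerProductSpace.toDual ℝ (HZero s)

theorem riesz_apply (u v : HZero s) : riesz s u v = ⟪u, v⟫ := rfl

theorem inner_riesz_symm (F : HNeg s) (v : HZero s) : ⟪(riesz s).symm F, v⟫ = F v := by
  rw [← riesz_apply, LinearIsometryEquiv.apply_symm_apply]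

theorem toHNeg_apply (E : Set ℝ) (f : L2 E) (v : HZero s) :
    toHNeg s E f v = ⟪f, restrictTo s E v⟫ := rfl

theorem toHNeg_eq_riesz (E : Set ℝ) (f : L2 E) :
    toHNeg s E f = riesz s ((restrictTo s E).adjoint f) := by
  ext v
  rw [toHNeg_apply, riesz_apply, ContinuousLinearMap.adjoint_inner_left]

theorem toHNeg_add (E : Set ℝ) (f g : L2 E) :
    toHNeg s E (f + g) = toHNeg s E f + toHNeg s E g := by
  simp only [toHNeg_eq_riesz, map_add]

theorem toHNeg_smul (E : Set ℝ) (c : ℝ) (f : L2 E) : toHNeg s E (c • f) = c • toHNeg s E f := by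
  simp only [toHNeg_eq_riesz, map_smul]

theorem memLp_riesz {y : ℝ → HZero s} {μ : Measure ℝ} (hy : MemLp y 2 μ) :
    MemLp (fun t => riesz s (y t)) 2 μ :=
  (riesz s).toContinuousLinearEquiv.toContinuousLinearMap.comp_memLp' hy

theorem memLp_riesz_symm {F : ℝ → HNeg s} {μ : Measure ℝ} (hF : MemLp F 2 μ) :
    MemLp (fun t => (riesz s).symm (F t)) 2 μ :=
  (riesz s).symm.toContinuousLinearEquiv.toContinuousLinearMap.comp_memLp' hF

theorem memLp_toHNeg {E : Set ℝ} {f : ℝ → L2 E} {μ : Measure ℝ} (hf : MemLp f 2 μ) :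
    MemLp (fun t => toHNeg s E (f t)) 2 μ := by
  simp only [toHNeg_eq_riesz]
  exact memLp_riesz ((restrictTo s E).adjoint.comp_memLp' hf)

theorem integrable_apply {F : ℝ → HNeg s} {w : ℝ → HZero s} {μ : Measure ℝ} (hF : MemLp F 2 μ)
    (hw : MemLp w 2 μ) : Integrable (fun t => F t (w t)) μ :=
  memLp_one_iff_integrable.1
    ((ContinuousLinearMap.id ℝ (HNeg s)).memLp_of_bilin (r := 1) hF hw)

theorem integrable_fracForm {y w : ℝ → HZero s} {μ : Measure ℝ} (hy : MemLp y 2 μ)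
    (hw : MemLp w 2 μ) : Integrable (fun t => fracForm s (y t) (w t)) μ := by
  simp only [← inner_fracOp, ← riesz_apply]
  exact integrable_apply (memLp_riesz ((fracOp s).comp_memLp' hy)) hw

theorem fracForm_add_smul_left (u v w : HZero s) (c : ℝ) :
    fracForm s (u + c • v) w = fracForm s u w + c * fracForm s v w := by
  simp only [← inner_fracOp, map_add, map_smul, inner_add_left, real_inner_smul_left]

theorem integrable_smul_of_continuous {X : Type*} [NormedAddCommGroup X] [NormedSpace ℝ X]
    {g : ℝ → ℝ} (hg : Continuous g) {x : ℝ → X} (hx : MemLp x 2 (volume.restrict (Ioo 0 τ))) :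
    Integrable (fun t => g t • x t) (volume.restrict (Ioo 0 τ)) :=
  memLp_one_iff_integrable.1 (hx.smul (r := 1) (memLp_of_continuousOn hg.continuousOn))

/-! #### Time reversal -/

theorem measurePreserving_reflect (τ : ℝ) : MeasurePreserving (fun t => τ - t)
    (volume.restrict (Ioo 0 τ)) (volume.restrict (Ioo 0 τ)) := by
  have h := (Measure.measurePreserving_sub_left (volume : Measure ℝ) τ).restrict_preimage
    (s := Ioo 0 τ) measurableSet_Ioo
  simpa using h

theorem integral_reflect {X : Type*} [NormedAddCommGroup X] [NormedSpace ℝ X] (f : ℝ → X) :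
    ∫ t in Ioo 0 τ, f (τ - t) = ∫ t in Ioo 0 τ, f t :=
  (measurePreserving_reflect τ).integral_comp
    (Homeomorph.subLeft τ).measurableEmbedding f

theorem memLp_reflect {X : Type*} [NormedAddCommGroup X] {f : ℝ → X}
    (hf : MemLp f 2 (volume.restrict (Ioo 0 τ))) :
    MemLp (fun t => f (τ - t)) 2 (volume.restrict (Ioo 0 τ)) :=
  hf.comp_measurePreserving (measurePreserving_reflect τ)

theorem continuousOn_reflect {X : Type*} [TopologicalSpace X] {u : ℝ → X}
    (hu : ContinuousOn u (Icc 0 τ)) : ContinuousOn (fun t => u (τ - t)) (Icc 0 τ) :=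
  hu.comp (by fun_prop) fun t ht => ⟨by linarith [ht.2], by linarith [ht.1]⟩

theorem InW.reflect {y : ℝ → HZero s} {y' : ℝ → HNeg s} (h : InW s τ y y') :
    InW s τ (fun t => y (τ - t)) (fun t => -y' (τ - t)) where
  memLp := memLp_reflect h.memLp
  memLp_deriv := (memLp_reflect h.memLp_deriv).neg
  weak_deriv η hη hηc hηs := by
    have hder : ∀ t, deriv (fun t => η (τ - t)) t = -deriv η (τ - t) := fun t =>
      deriv_comp_const_sub _ _ _
    have h1 := h.weak_deriv (fun t => η (τ - t)) (hη.comp (by fun_prop))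
      (hηc.comp_homeomorph (Homeomorph.subLeft τ)) ?_
    · have hneg : ∀ t, (-deriv η (τ - t)) • toHNeg s Omega (restrictTo s Omega (y t)) =
          -(deriv η (τ - t) • toHNeg s Omega (restrictTo s Omega (y t))) :=
        fun t => neg_smul (M := HNeg s) _ (toHNeg s Omega (restrictTo s Omega (y t)))
      simp only [hder, hneg, integral_neg, neg_inj] at h1
      rw [← integral_reflect (τ := τ), ← integral_reflect (τ := τ) (fun t => η t • -y' (τ - t))]
      simp only [sub_sub_cancel, smul_neg, integral_neg, neg_neg]
      exact h1
    · have h2 : tsupport (fun t => η (τ - t)) = (fun t => τ - t) ⁻¹' tsupport η :=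
        tsupport_comp_eq_preimage η (Homeomorph.subLeft τ)
      rw [h2]
      intro t ht
      have := hηs ht
      exact ⟨by linarith [this.2], by linarith [this.1]⟩

theorem IsForwardSolution.reflect {F : ℝ → HNeg s} {u₀ : L2 Omega} {u : ℝ → L2 Omega}
    (h : IsForwardSolution s τ (fun t => F (τ - t)) u₀ u) :
    IsBackwardSolution s τ F u₀ fun t => u (τ - t) where
  continuousOn := continuousOn_reflect h.continuousOn
  terminal := by rw [sub_self, h.initial]
  equation := by
    obtain ⟨y, y', hW, hae, heq⟩ := h.equation
    refine ⟨_, _, hW.reflect, (measurePreserving_reflect τ).quasiMeasurePreserving.ae hae,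
      fun w hw => ?_⟩
    have h1 := heq _ (memLp_reflect hw)
    rw [← integral_reflect (fun t => (-y' (τ - t)) (w t)),
      ← integral_reflect (fun t => fracForm s (y (τ - t)) (w t)),
      ← integral_reflect (fun t => F t (w t)), ← h1]
    simp only [sub_sub_cancel, neg_apply, integral_neg, neg_neg]

/-! #### Existence -/

theorem coeFn_toLp_riesz_symm {F : ℝ → HNeg s} (hF : MemLp F 2 (volume.restrict (Ioo 0 τ))) :
    ∀ᵐ t ∂volume.restrict (Ioo 0 τ), 
      (MemLp.toLp _ (memLp_riesz_symm hF) : TimeL2 τ (HZero s)) t = (riesz s).symm (F t) :=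
  MemLp.coeFn_toLp _

theorem gram_restrictTo (u : HZero s) :
    riesz s (gram (restrictTo s Omega) u) = toHNeg s Omega (restrictTo s Omega u) := by
  rw [toHNeg_eq_riesz]
  rfl

theorem IsLimitSolution.isForwardSolution {hτ : 0 ≤ τ} {F : ℝ → HNeg s}
    (hF : MemLp F 2 (volume.restrict (Ioo 0 τ))) {u₀ : L2 Omega} {u : ℝ → L2 Omega}
    {y : TimeL2 τ (HZero s)} (h : IsLimitSolution hτ (restrictTo s Omega) (fracOp s) u₀
      (memLp_riesz_symm hF).toLp u y) : IsForwardSolution s τ F u₀ u where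
  continuousOn := h.continuousOn
  initial := h.initial
  equation := by
    have hy : MemLp y 2 (volume.restrict (Ioo 0 τ)) := Lp.memLp y
    have hf := Lp.memLp (memLp_riesz_symm hF).toLp
    have hy' := memLp_riesz (hf.sub ((fracOp s).comp_memLp' hy))
    refine ⟨y, _, ⟨hy, hy', fun η hη hηc hηs => ?_⟩, h.ae_eq, fun w hw => ?_⟩
    · have h1 := congrArg (riesz s) (h.weak_deriv hη hηs)
      have e : ∀ x : ℝ → HZero s, riesz s (∫ t in Ioo 0 τ, x t) = ∫ t in Ioo 0 τ, riesz s (x t) :=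
        fun x => ((riesz s).toContinuousLinearEquiv.integral_comp_comm x).symm
      rw [map_neg, e, e] at h1
      simp only [map_smul, gram_restrictTo] at h1
      exact h1
    · rw [← integral_add (integrable_apply hy' hw) (integrable_fracForm hy hw)]
      refine integral_congr_ae ?_
      filter_upwards [coeFn_toLp_riesz_symm hF] with t ht
      rw [Pi.sub_apply, riesz_apply, inner_sub_left, Function.comp_apply, inner_fracOp, ht,
        inner_riesz_symm, sub_add_cancel]

/-- Stated for a general space, since unifying the instances in `MemLp.zero` directly in the dual
space `HNeg s` is expensive. -/
theorem memLp_two_zero (X : Type*) [NormedAddCommGroup X] (μ : Measure ℝ) :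
    MemLp (0 : ℝ → X) 2 μ := MemLp.zero

theorem exists_isForwardSolution (hs₀ : 0 < s) (hs₁ : s < 1) (hτ : 0 < τ) {F : ℝ → HNeg s}
    (hF : MemLp F 2 (volume.restrict (Ioo 0 τ))) (u₀ : L2 Omega) :
    ∃ u, IsForwardSolution s τ F u₀ u := by
  obtain ⟨c, hc, hB⟩ := exists_coercive hs₀ hs₁
  obtain ⟨u, y, h⟩ := exists_isLimitSolution hτ.le (denseRange_restrictTo hs₀ hs₁) hc hB u₀
    (memLp_riesz_symm hF).toLp
  exact ⟨u, h.isForwardSolution hF⟩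

/-- A continuous representative of `y ∈ W(0,τ)` is a primitive of its time derivative, as a
function with values in `H^{-s}(Ω)`. -/
theorem InW.adjoint_eq_add_integral (hτ : 0 < τ) {y : ℝ → HZero s} {y' : ℝ → HNeg s}
    (h : InW s τ y y') {r : ℝ → L2 Omega} (hr : ContinuousOn r (Icc 0 τ))
    (hry : ∀ᵐ t ∂volume.restrict (Ioo 0 τ), r t = restrictTo s Omega (y t)) :
    ∀ t ∈ Icc 0 τ, (restrictTo s Omega).adjoint (r t) =
      (restrictTo s Omega).adjoint (r 0) + ∫ ρ in 0..t, (riesz s).symm (y' ρ) := by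
  refine eq_add_integral_of_weak_deriv hτ
    (((restrictTo s Omega).adjoint.continuous).comp_continuousOn hr)
    (integrableOn_Ioc_of_memLp (memLp_riesz_symm h.memLp_deriv)) fun η hη hηc hηs => ?_
  have h1 := congrArg (riesz s).symm (h.weak_deriv η hη hηc hηs)
  have e : ∀ x : ℝ → HNeg s, (riesz s).symm (∫ t in Ioo 0 τ, x t) =
      ∫ t in Ioo 0 τ, (riesz s).symm (x t) :=
    fun x => ((riesz s).symm.toContinuousLinearEquiv.integral_comp_comm x).symm
  rw [map_neg, e, e] at h1
  simp only [map_smul] at h1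
  rw [← h1]
  refine integral_congr_ae ?_
  filter_upwards [hry] with t ht
  rw [ht, toHNeg_eq_riesz, LinearIsometryEquiv.symm_apply_apply]

/-- The backward problem has a solution that satisfies Green's formula against every solution of
the homogeneous forward problem. -/
theorem exists_isBackwardSolution (hs₀ : 0 < s) (hs₁ : s < 1) (hτ : 0 < τ) {F : ℝ → HNeg s}
    (hF : MemLp F 2 (volume.restrict (Ioo 0 τ))) (u₁ : L2 Omega) :
    ∃ z, IsBackwardSolution s τ F u₁ z ∧ ∀ (p : ℝ → L2 Omega) (y : ℝ → HZero s)
      (y' : ℝ → HNeg s), ContinuousOn p (Icc 0 τ) → InW s τ y y' →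
      (∀ᵐ t ∂volume.restrict (Ioo 0 τ), p t = restrictTo s Omega (y t)) →
      (∀ w : ℝ → HZero s, MemLp w 2 (volume.restrict (Ioo 0 τ)) →
        (∫ t in Ioo 0 τ, y' t (w t)) + ∫ t in Ioo 0 τ, fracForm s (y t) (w t) = 0) →
      ⟪z 0, p 0⟫ - ⟪u₁, p τ⟫ = ∫ t in Ioo 0 τ, F t (y t) := by
  obtain ⟨c, hc, hB⟩ := exists_coercive hs₀ hs₁
  have hFr : MemLp (fun t => F (τ - t)) 2 (volume.restrict (Ioo 0 τ)) := memLp_reflect hF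
  obtain ⟨u, v, h⟩ := exists_isLimitSolution hτ.le (denseRange_restrictTo hs₀ hs₁) hc hB u₁
    (memLp_riesz_symm hFr).toLp
  refine ⟨fun t => u (τ - t), (h.isForwardSolution hFr).reflect, ?_⟩
  intro p y y' hp hW hae heq
  have hWr := hW.reflect
  have haer : ∀ᵐ t ∂volume.restrict (Ioo 0 τ), p (τ - t) = restrictTo s Omega (y (τ - t)) :=
    (measurePreserving_reflect τ).quasiMeasurePreserving.ae hae
  have hprim := hWr.adjoint_eq_add_integral hτ (continuousOn_reflect hp) haer
  set q : TimeL2 τ (HZero s) := hWr.memLp.toLp with hq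
  set g : TimeL2 τ (HZero s) := (memLp_riesz_symm hWr.memLp_deriv).toLp with hg
  have hqe : ∀ᵐ t ∂volume.restrict (Ioo 0 τ), q t = y (τ - t) := hWr.memLp.coeFn_toLp
  have hge : ∀ᵐ t ∂volume.restrict (Ioo 0 τ), g t = (riesz s).symm (-y' (τ - t)) :=
    coeFn_toLp_riesz_symm hWr.memLp_deriv
  have hgreen := h.green (r := fun t => p (τ - t)) (q := q) (g := g)
    (by filter_upwards [haer, hqe] with t h1 h2; rw [h1, h2]) (fun t ht => by
      rw [hprim t ht]
      congr 1
      rw [intervalIntegral.integral_of_le ht.1, intervalIntegral.integral_of_le ht.1]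
      refine integral_congr_ae ?_
      rw [Measure.restrict_congr_set Ioo_ae_eq_Ioc.symm]
      exact ae_restrict_of_ae_restrict_of_subset (Ioo_subset_Ioo_right ht.2)
        (hge.mono fun t ht => ht.symm))
  simp only [sub_self, sub_zero] at hgreen
  simp only [sub_zero]
  rw [hgreen, inner_sub_left]
  -- the equation of `p`, tested with the reflected trajectory of `z`
  have h1 := heq _ (memLp_reflect (Lp.memLp v))
  rw [← integral_reflect, ← integral_reflect (fun t => fracForm s _ _)] at h1
  simp only [sub_sub_cancel] at h1
  have e1 : ⟪v, g⟫ = -∫ t in Ioo 0 τ, y' (τ - t) (v t) := by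
    rw [L2.inner_def, ← integral_neg]
    refine integral_congr_ae ?_
    filter_upwards [hge] with t ht
    rw [ht, real_inner_comm, inner_riesz_symm, neg_apply]
  have e2 : ⟪(fracOp s).compLpL 2 _ v, q⟫ = ∫ t in Ioo 0 τ, fracForm s (y (τ - t)) (v t) := by
    rw [L2.inner_def]
    refine integral_congr_ae ?_
    filter_upwards [hqe, (fracOp s).coeFn_compLpL v] with t h2 h3
    rw [h2, h3, inner_fracOp, fracForm_comm]
  have e3 : ⟪(memLp_riesz_symm hFr).toLp, q⟫ = ∫ t in Ioo 0 τ, F t (y t) := by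
    rw [L2.inner_def, ← integral_reflect (fun t => F t (y t))]
    refine integral_congr_ae ?_
    filter_upwards [hqe, coeFn_toLp_riesz_symm hFr] with t h2 h3
    rw [h2, h3, inner_riesz_symm]
  rw [e1, e2, e3]
  linarith

/-! ### States of controls and the optimality condition -/

/-- Stated for a general space, since unifying the instances in `MemLp.add` directly in the dual
space `HNeg s` is expensive. -/
theorem memLp_add_smul {X : Type*} [NormedAddCommGroup X] [NormedSpace ℝ X] {f g : ℝ → X}
    {μ : Measure ℝ} (hf : MemLp f 2 μ) (hg : MemLp g 2 μ) (c : ℝ) :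
    MemLp (fun t => f t + c • g t) 2 μ :=
  hf.add (hg.const_smul c)

theorem weak_deriv_add_smul {X : Type*} [NormedAddCommGroup X] [NormedSpace ℝ X]
    {x₁ x₂ x₁' x₂' : ℝ → X} {g g' : ℝ → ℝ} (hg : Continuous g) (hg' : Continuous g')
    (h₁ : MemLp x₁ 2 (volume.restrict (Ioo 0 τ))) (h₂ : MemLp x₂ 2 (volume.restrict (Ioo 0 τ)))
    (h₁' : MemLp x₁' 2 (volume.restrict (Ioo 0 τ)))
    (h₂' : MemLp x₂' 2 (volume.restrict (Ioo 0 τ)))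
    (e₁ : ∫ t in Ioo 0 τ, g' t • x₁ t = -∫ t in Ioo 0 τ, g t • x₁' t)
    (e₂ : ∫ t in Ioo 0 τ, g' t • x₂ t = -∫ t in Ioo 0 τ, g t • x₂' t) (c : ℝ) :
    ∫ t in Ioo 0 τ, g' t • (x₁ t + c • x₂ t) = -∫ t in Ioo 0 τ, g t • (x₁' t + c • x₂' t) := by
  simp only [smul_add, smul_comm _ c]
  rw [integral_add (integrable_smul_of_continuous hg' h₁)
      ((integrable_smul_of_continuous hg' h₂).fun_smul c),
    integral_add (integrable_smul_of_continuous hg h₁')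
      ((integrable_smul_of_continuous hg h₂').fun_smul c)]
  simp only [integral_smul]
  rw [e₁, e₂, smul_neg, neg_add]

theorem InW.add_smul {y₁ y₂ : ℝ → HZero s} {y₁' y₂' : ℝ → HNeg s} (h₁ : InW s τ y₁ y₁')
    (h₂ : InW s τ y₂ y₂') (c : ℝ) :
    InW s τ (fun t => y₁ t + c • y₂ t) (fun t => y₁' t + c • y₂' t) where
  memLp := memLp_add_smul h₁.memLp h₂.memLp c
  memLp_deriv := memLp_add_smul (X := HNeg s) h₁.memLp_deriv h₂.memLp_deriv c
  weak_deriv η hη hηc hηs := by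
    have e : ∀ t, toHNeg s Omega (restrictTo s Omega (y₁ t + c • y₂ t)) =
        toHNeg s Omega (restrictTo s Omega (y₁ t)) +
          c • toHNeg s Omega (restrictTo s Omega (y₂ t)) := by
      intro t
      rw [map_add, map_smul, toHNeg_add, toHNeg_smul]
    simp only [e]
    exact weak_deriv_add_smul (X := HNeg s) hη.continuous (hη.continuous_deriv (by simp))
      (memLp_toHNeg ((restrictTo s Omega).comp_memLp' h₁.memLp))
      (memLp_toHNeg ((restrictTo s Omega).comp_memLp' h₂.memLp))
      h₁.memLp_deriv h₂.memLp_deriv (h₁.weak_deriv η hη hηc hηs) (h₂.weak_deriv η hη hηc hηs) c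

theorem IsBackwardSolution.add_smul {F₁ F₂ : ℝ → HNeg s}
    (hF₁ : MemLp F₁ 2 (volume.restrict (Ioo 0 τ))) (hF₂ : MemLp F₂ 2 (volume.restrict (Ioo 0 τ)))
    {a b : L2 Omega} {u v : ℝ → L2 Omega} (hu : IsBackwardSolution s τ F₁ a u)
    (hv : IsBackwardSolution s τ F₂ b v) (c : ℝ) :
    IsBackwardSolution s τ (fun t => F₁ t + c • F₂ t) (a + c • b) (fun t => u t + c • v t) where
  continuousOn := hu.continuousOn.add (hv.continuousOn.const_smul c)
  terminal := by rw [hu.terminal, hv.terminal]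
  equation := by
    obtain ⟨y₁, y₁', hW₁, hae₁, heq₁⟩ := hu.equation
    obtain ⟨y₂, y₂', hW₂, hae₂, heq₂⟩ := hv.equation
    refine ⟨_, _, hW₁.add_smul hW₂ c, ?_, fun w hw => ?_⟩
    · filter_upwards [hae₁, hae₂] with t h1 h2
      rw [h1, h2, map_add, map_smul]
    · simp only [add_apply, smul_apply, smul_eq_mul, fracForm_add_smul_left]
      rw [integral_add (integrable_apply hW₁.memLp_deriv hw)
          ((integrable_apply hW₂.memLp_deriv hw).const_mul c),
        integral_add (integrable_fracForm hW₁.memLp hw)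
          ((integrable_fracForm hW₂.memLp hw).const_mul c),
        integral_add (integrable_apply hF₁ hw) ((integrable_apply hF₂ hw).const_mul c)]
      simp only [integral_const_mul]
      rw [← heq₁ w hw, ← heq₂ w hw]
      ring

theorem IsBackwardSolution.congr_ae {F G : ℝ → HNeg s} {a : L2 Omega} {u : ℝ → L2 Omega}
    (hu : IsBackwardSolution s τ F a u) (hFG : F =ᵐ[volume.restrict (Ioo 0 τ)] G) :
    IsBackwardSolution s τ G a u where
  continuousOn := hu.continuousOn
  terminal := hu.terminal
  equation := by
    obtain ⟨y, y', hW, hae, heq⟩ := hu.equation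
    refine ⟨y, y', hW, hae, fun w hw => (heq w hw).trans (integral_congr_ae ?_)⟩
    filter_upwards [hFG] with t ht
    rw [ht]

variable {ω : Set ℝ}

theorem IsState.add_smul {φ₀ : L2 Omega} {h k : Control τ ω} {φ z : ℝ → L2 Omega}
    (hφ : IsState s τ ω φ₀ h φ) (hz : IsState s τ ω 0 k z) (c : ℝ) :
    IsState s τ ω φ₀ (h + c • k) fun t => φ t + c • z t := by
  have e := IsBackwardSolution.add_smul (memLp_toHNeg (Lp.memLp h)) (memLp_toHNeg (Lp.memLp k))
    hφ hz c
  rw [smul_zero, add_zero] at e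
  refine e.congr_ae ?_
  filter_upwards [Lp.coeFn_add h (c • k), Lp.coeFn_smul c k] with t h1 h2
  rw [h1, Pi.add_apply, h2, Pi.smul_apply, toHNeg_add, toHNeg_smul]

theorem cost_eq (ε : ℝ) (h : Control τ ω) (φ : ℝ → L2 Omega) :
    cost ε h φ = 1 / 2 * ‖h‖ ^ 2 + ε / 2 * ‖φ 0‖ ^ 2 := by
  have e : ∀ f : L2 ω, ∫ x in ω, |f x| ^ 2 = ‖f‖ ^ 2 := by
    intro f
    rw [← real_inner_self_eq_norm_sq, L2.inner_def]
    simp only [real_inner_self_eq_norm_sq, Real.norm_eq_abs]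
  rw [cost, TimeL2.norm_sq h]
  simp only [e]

/-- The Euler–Lagrange equation of `J_ε`: its derivative at a minimizer vanishes in the direction of
every control `k`. -/
theorem IsMinimizer.inner_add_eq_zero {ε : ℝ} {φ₀ : L2 Omega} {h k : Control τ ω}
    (hmin : IsMinimizer s τ ε ω φ₀ h) {φ z : ℝ → L2 Omega} (hφ : IsState s τ ω φ₀ h φ)
    (hz : IsState s τ ω 0 k z) : ⟪h, k⟫ + ε * ⟪φ 0, z 0⟫ = 0 := by
  have hquad : ∀ c : ℝ, 0 ≤ (1 / 2 * ‖k‖ ^ 2 + ε / 2 * ‖z 0‖ ^ 2) * (c * c) +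
      (⟪h, k⟫ + ε * ⟪φ 0, z 0⟫) * c + 0 := by
    intro c
    have e := hmin φ hφ _ _ (hφ.add_smul hz c)
    rw [cost_eq, cost_eq, norm_add_sq_real, norm_add_sq_real, norm_smul, norm_smul,
      real_inner_smul_right, real_inner_smul_right, mul_pow, mul_pow, Real.norm_eq_abs,
      sq_abs] at e
    linarith
  have hd := discrim_le_zero hquad
  rw [discrim, mul_zero, sub_zero] at hd
  exact pow_eq_zero_iff two_ne_zero |>.1 (le_antisymm hd (sq_nonneg _))

end Solutions

end FracHeat

open FracHeat in
theorem theorem4p2 (s τ ε : ℝ) (hs₀ : 0 < s) (hs₁ : s < 1) (hτ : 0 < τ) (hε : 0 < ε)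
    (ω : Set ℝ) (hω_meas : MeasurableSet ω) (hω : ω ⊆ FracHeat.Omega)
    (φ₀ : FracHeat.L2 FracHeat.Omega) (h : FracHeat.Control τ ω)
    (hmin : FracHeat.IsMinimizer s τ ε ω φ₀ h) :
    (∃ φ : ℝ → FracHeat.L2 FracHeat.Omega, FracHeat.IsState s τ ω φ₀ h φ) ∧
    ∀ φ : ℝ → FracHeat.L2 FracHeat.Omega, FracHeat.IsState s τ ω φ₀ h φ →
      (∃ p : ℝ → FracHeat.L2 FracHeat.Omega, FracHeat.IsAdjointState s τ (ε • φ 0) p) ∧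
      ∀ p : ℝ → FracHeat.L2 FracHeat.Omega, FracHeat.IsAdjointState s τ (ε • φ 0) p →
        ∀ᵐ t ∂volume.restrict (Ioo 0 τ), ∀ᵐ x ∂volume.restrict ω, h t x + p t x = 0 := by
  have hstate : ∀ (k : Control τ ω), MemLp (fun t => toHNeg s ω (k t)) 2
      (volume.restrict (Ioo 0 τ)) := fun k => memLp_toHNeg (Lp.memLp k)
  refine ⟨?_, fun φ hφ => ⟨?_, fun p hp => ?_⟩⟩
  · obtain ⟨φ, hφ, -⟩ := exists_isBackwardSolution hs₀ hs₁ hτ (hstate h) φ₀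
    exact ⟨φ, hφ⟩
  · exact exists_isForwardSolution hs₀ hs₁ hτ (memLp_two_zero (HNeg s) _) _
  · obtain ⟨y, y', hW, hae, heq⟩ := hp.equation
    set q : Control τ ω := ((restrictTo s ω).comp_memLp' hW.memLp).toLp with hq
    have hqe : ∀ᵐ t ∂volume.restrict (Ioo 0 τ), q t = restrictTo s ω (y t) :=
      MemLp.coeFn_toLp _
    -- the gradient of the functional at `h`
    set k : Control τ ω := h + q with hk
    obtain ⟨z, hz, hgreen⟩ := exists_isBackwardSolution hs₀ hs₁ hτ (hstate k) 0
    have h1 := hgreen p y y' hp.continuousOn hW hae fun w hw => by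
      rw [heq w hw]
      simp
    have h2 : ∫ t in Ioo 0 τ, toHNeg s ω (k t) (y t) = inner ℝ k q := by
      rw [L2.inner_def]
      refine integral_congr_ae ?_
      filter_upwards [hqe] with t ht
      rw [ht, toHNeg_apply]
    rw [h2, inner_zero_left, sub_zero, hp.initial, real_inner_smul_right, real_inner_comm] at h1
    have h3 := hmin.inner_add_eq_zero hφ hz
    rw [h1, real_inner_comm k h, ← inner_add_right, ← hk, inner_self_eq_zero] at h3
    have h4 := Lp.coeFn_add h q
    rw [← hk, h3] at h4
    filter_upwards [h4, Lp.coeFn_zero (L2 ω) 2 (volume.restrict (Ioo 0 τ)), hqe, hae]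
      with t h5 h6 h7 h8
    rw [h6, Pi.zero_apply, Pi.add_apply, h7] at h5
    have h9 := Lp.coeFn_add (h t) (restrictTo s ω (y t))
    rw [← h5] at h9
    filter_upwards [h9, Lp.coeFn_zero ℝ 2 (volume.restrict ω), coeFn_restrictTo ω (y t),
      ae_restrict_of_ae_restrict_of_subset hω (coeFn_restrictTo Omega (y t))] with x e1 e2 e3 e4
    rw [e2, Pi.zero_apply, Pi.add_apply, e3] at e1
    rw [h8, e4, ← e1]

end
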